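/- Manifolds are smooth and finite-dimensional. Let $p\colon S\to B$ be a smooth fibre bundle and $\Omega\in\Omega^2(S)$ a closed $2$-form whose restriction to every fibre $S_b=p^{-1}(b)$ is symplectic. Assume that $(S\to B,\Omega)$ is prequantized: $q\colon X\to S$ is a principal $\mathbb S^1$-bundle ($\mathbb S^1=\mathbb R/2\pi\mathbb Z$) with a connection $1$-form $\Theta\in\Omega^1(X)$ (that is, $\Theta$ is $\mathbb S^1$-invariant and equals $1$ on the generator of the action) of curvature $\Omega$, i.e. $d\Theta=q^*\Omega$. (Such $(X,\Theta)$ exists if and only if $[\Omega/2\pi]\in H^2(S;\mathbb R)$ is integral.) Put $\pi=p\circ q\colon X\to B$, with vertical tangent spaces $\ker dp\subset TS$ and $\ker d\pi\subset TX$. Then $\Theta$ restricts to a contact form on each fibre of $\pi$, so that the following brackets are defined. On $S$: $\{f,g\}_S=\Pi(df,dg)$, where $\Pi$ is the inverse of $\Omega$ on the vertical tangent spaces, i.e. $\Pi(\alpha,\beta)=\Omega(\alpha^\sharp,\beta^\sharp)$ with $\alpha^\sharp\in\ker dp$ determined by $\Omega(\alpha^\sharp,w)=\alpha(w)$ for all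 $w\in\ker dp$. On $X$: $\{f,g\}_X=\Lambda(df,dg)+f\,R(g)-g\,R(f)$, where $\Lambda$ is in the same way the inverse of the symplectic form $d\Theta$ on $\ker d\pi\cap\ker\Theta$, and $R$ is the vertical Reeb field: $R\in\ker d\pi$, $\Theta(R)=1$, $d\Theta(R,w)=0$ for all $w\in\ker d\pi$. Theorem. $\{\cdot,\cdot\}_S$ is a Poisson bracket on $C^\infty(S)$, $\{\cdot,\cdot\}_X$ is a Jacobi bracket on $C^\infty(X)$ (a Lie bracket that is a first order differential operator in each argument), and $q\colon X\to S$ is a Jacobi map: it is smooth and $$\{f\circ q,\,g\circ q\}_X=\{f,g\}_S\circ q\qquad\text{for all } f,g\in C^\infty(S).$$ -/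

import Mathlib

open scoped ContDiff Manifold

noncomputable section

/-! ### Differential forms on smooth manifolds

Manifolds are modelled on a finite-dimensional real vector space `E` (no boundary). -/

section Forms

variable {E : Type*} [NormedAddCommGroup E] [NormedSpace ℝ E]
  {M : Type*} [TopologicalSpace M] [ChartedSpace E M] {k : ℕ}

/-- The derivative at `x` of the preferred chart at `x`. -/
def chartDeriv (x : M) : TangentSpace 𝓘(ℝ, E) x →L[ℝ] E :=
  mfderiv 𝓘(ℝ, E) 𝓘(ℝ, E) (extChartAt 𝓘(ℝ, E) x) x

/-- The derivative at `y` of the inverse of the preferred chart around `x₀`. -/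
def chartSymmDeriv (x₀ : M) (y : E) :
    E →L[ℝ] TangentSpace 𝓘(ℝ, E) ((extChartAt 𝓘(ℝ, E) x₀).symm y) :=
  mfderiv 𝓘(ℝ, E) 𝓘(ℝ, E) (extChartAt 𝓘(ℝ, E) x₀).symm y

/-- The expression of a (set-theoretic) `k`-form in the preferred chart `φ` around `x₀`, i.e. its
pullback under `φ⁻¹`. -/
def formInChart (η : ∀ x : M, TangentSpace 𝓘(ℝ, E) x [⋀^Fin k]→L[ℝ] ℝ) (x₀ : M) :
    E → E [⋀^Fin k]→L[ℝ] ℝ :=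
  fun y => (η ((extChartAt 𝓘(ℝ, E) x₀).symm y)).compContinuousLinearMap (chartSymmDeriv x₀ y)

variable (E M k) in
/-- Smooth differential `k`-forms on the manifold `M`: families of alternating forms on the tangent
spaces whose expression in every preferred chart is smooth. -/
structure DiffForm where
  toFun : ∀ x : M, TangentSpace 𝓘(ℝ, E) x [⋀^Fin k]→L[ℝ] ℝ
  smooth' : ∀ x₀ : M, ContDiffOn ℝ ∞ (formInChart toFun x₀) (extChartAt 𝓘(ℝ, E) x₀).target

instance : CoeFun (DiffForm E M k)
    (fun _ => ∀ x : M, TangentSpace 𝓘(ℝ, E) x [⋀^Fin k]→L[ℝ] ℝ) :=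
  ⟨DiffForm.toFun⟩

/-- The exterior derivative of `η` at `x`: the exterior derivative of the expression of `η` in the
preferred chart at `x`, transported back to `T_x M` by the derivative of the chart. -/
def DiffForm.d (η : DiffForm E M k) (x : M) : TangentSpace 𝓘(ℝ, E) x [⋀^Fin (k + 1)]→L[ℝ] ℝ :=
  (extDeriv (formInChart η.toFun x) (extChartAt 𝓘(ℝ, E) x x)).compContinuousLinearMap
    (chartDeriv x)

/-- Closed differential forms. -/
def DiffForm.IsClosed (η : DiffForm E M k) : Prop := ∀ x, η.d x = 0

end Forms

/-! ### Jacobi brackets and Jacobi maps -/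

section Jacobi

variable {E : Type*} [NormedAddCommGroup E] [NormedSpace ℝ E]
  {M : Type*} [TopologicalSpace M] [ChartedSpace E M]
  {E' : Type*} [NormedAddCommGroup E'] [NormedSpace ℝ E']
  {M' : Type*} [TopologicalSpace M'] [ChartedSpace E' M']

variable (E) in
/-- `br` is a Jacobi bracket on the manifold `M`: a Lie bracket on `C^∞(M)` which is a first order
differential operator in each argument. The last condition is the generalised Leibniz rule
`{f, gh} = g {f, h} + h {f, g} - g h {f, 1}`. -/
structure IsJacobiBracket (br : (M → ℝ) → (M → ℝ) → M → ℝ) : Prop where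
  contMDiff : ∀ f g : M → ℝ, ContMDiff 𝓘(ℝ, E) 𝓘(ℝ, ℝ) ∞ f → ContMDiff 𝓘(ℝ, E) 𝓘(ℝ, ℝ) ∞ g →
    ContMDiff 𝓘(ℝ, E) 𝓘(ℝ, ℝ) ∞ (br f g)
  add_right : ∀ f g h : M → ℝ, ContMDiff 𝓘(ℝ, E) 𝓘(ℝ, ℝ) ∞ f →
    ContMDiff 𝓘(ℝ, E) 𝓘(ℝ, ℝ) ∞ g → ContMDiff 𝓘(ℝ, E) 𝓘(ℝ, ℝ) ∞ h →
    br f (g + h) = br f g + br f h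
  smul_right : ∀ (c : ℝ) (f g : M → ℝ), ContMDiff 𝓘(ℝ, E) 𝓘(ℝ, ℝ) ∞ f →
    ContMDiff 𝓘(ℝ, E) 𝓘(ℝ, ℝ) ∞ g → br f (c • g) = c • br f g
  antisymm : ∀ f g : M → ℝ, ContMDiff 𝓘(ℝ, E) 𝓘(ℝ, ℝ) ∞ f →
    ContMDiff 𝓘(ℝ, E) 𝓘(ℝ, ℝ) ∞ g → br f g = - br g f
  jacobi : ∀ f g h : M → ℝ, ContMDiff 𝓘(ℝ, E) 𝓘(ℝ, ℝ) ∞ f →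
    ContMDiff 𝓘(ℝ, E) 𝓘(ℝ, ℝ) ∞ g → ContMDiff 𝓘(ℝ, E) 𝓘(ℝ, ℝ) ∞ h →
    br f (br g h) + br g (br h f) + br h (br f g) = 0
  leibniz : ∀ f g h : M → ℝ, ContMDiff 𝓘(ℝ, E) 𝓘(ℝ, ℝ) ∞ f →
    ContMDiff 𝓘(ℝ, E) 𝓘(ℝ, ℝ) ∞ g → ContMDiff 𝓘(ℝ, E) 𝓘(ℝ, ℝ) ∞ h →
    br f (g * h) = g * br f h + h * br f g - g * h * br f 1

variable (E) in
/-- A Poisson bracket is a Jacobi bracket for which the constant function `1` is central, i.e. a Lie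
bracket on `C^∞(M)` satisfying the Leibniz rule. -/
structure IsPoissonBracket (br : (M → ℝ) → (M → ℝ) → M → ℝ) : Prop
    extends IsJacobiBracket E br where
  one_right : ∀ f : M → ℝ, ContMDiff 𝓘(ℝ, E) 𝓘(ℝ, ℝ) ∞ f → br f 1 = 0

variable (E E') in
/-- `φ` is a Jacobi map between the Jacobi manifolds `(M, br)` and `(M', br')`: it is a smooth map
with `{f ∘ φ, g ∘ φ} = {f, g}' ∘ φ` for all smooth functions `f`, `g` on `M'`. -/
structure IsJacobiMap (br : (M → ℝ) → (M → ℝ) → M → ℝ) (br' : (M' → ℝ) → (M' → ℝ) → M' → ℝ)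
    (φ : M → M') : Prop where
  source : IsJacobiBracket E br
  target : IsJacobiBracket E' br'
  contMDiff : ContMDiff 𝓘(ℝ, E) 𝓘(ℝ, E') ∞ φ
  map_bracket : ∀ f g : M' → ℝ, ContMDiff 𝓘(ℝ, E') 𝓘(ℝ, ℝ) ∞ f →
    ContMDiff 𝓘(ℝ, E') 𝓘(ℝ, ℝ) ∞ g → br (f ∘ φ) (g ∘ φ) = br' f g ∘ φ

/-- The differential `(df)_x`, as a covector. -/
def differential (f : M → ℝ) (x : M) : TangentSpace 𝓘(ℝ, E) x →L[ℝ] ℝ :=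
  mfderiv 𝓘(ℝ, E) 𝓘(ℝ, ℝ) f x

/-- The bracket `{f, g} = Λ(df, dg) + f · R g - g · R f` of a field `Λ` of functions of
two covectors (below, bivectors) and a vector field `R`. -/
def tensorBracket
    (Λ : ∀ x : M, (TangentSpace 𝓘(ℝ, E) x →L[ℝ] ℝ) → (TangentSpace 𝓘(ℝ, E) x →L[ℝ] ℝ) → ℝ)
    (R : ∀ x : M, TangentSpace 𝓘(ℝ, E) x) (f g : M → ℝ) (x : M) : ℝ :=
  Λ x (differential f x) (differential g x)
    + f x * differential g x (R x) - g x * differential f x (R x)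

end Jacobi

/-! ### Inverting a symplectic form on a subspace -/

section Linear

variable {T : Type*} [AddCommGroup T] [Module ℝ T] [TopologicalSpace T]

/-- The 2-form `η` is nondegenerate on the subspace `W`. -/
def NondegenerateOn (η : T [⋀^Fin 2]→L[ℝ] ℝ) (W : Submodule ℝ T) : Prop :=
  ∀ u ∈ W, (∀ w ∈ W, η ![u, w] = 0) → u = 0

open Classical in
/-- The inverse of `η^♭ : W → W^*`, `u ↦ η(u, ·)`, applied to the restriction `α|_W`: the vector
`u ∈ W` with `η(u, w) = α(w)` for all `w ∈ W`. It exists and is unique if `W` is finite-dimensional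
and `η` is nondegenerate on `W`. -/
def sharp (η : T [⋀^Fin 2]→L[ℝ] ℝ) (W : Submodule ℝ T) (α : T →L[ℝ] ℝ) : T :=
  if h : ∃ u ∈ W, ∀ w ∈ W, η ![u, w] = α w then h.choose else 0

/-- The bivector `(α, β) ↦ η(α^♯, β^♯)` inverse to the symplectic form `η` on `W`. -/
def inverseBivector (η : T [⋀^Fin 2]→L[ℝ] ℝ) (W : Submodule ℝ T) (α β : T →L[ℝ] ℝ) : ℝ :=
  η ![sharp η W α, sharp η W β]

theorem sharp_eq {η : T [⋀^Fin 2]→L[ℝ] ℝ} {W : Submodule ℝ T} (hη : NondegenerateOn η W)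
    {α : T →L[ℝ] ℝ} {u : T} (hu : u ∈ W) (h : ∀ w ∈ W, η ![u, w] = α w) :
    sharp η W α = u := by
  have hex : ∃ u ∈ W, ∀ w ∈ W, η ![u, w] = α w := ⟨u, hu, h⟩
  have hs : sharp η W α = hex.choose := by rw [sharp, dif_pos hex]
  obtain ⟨h1, h2⟩ := hex.choose_spec
  rw [hs, ← sub_eq_zero]
  refine hη _ (W.sub_mem h1 hu) fun w hw => ?_
  have := η.toAlternatingMap.map_vecCons_add ![w] (hex.choose - u) u
  rw [sub_add_cancel] at this
  have h3 : η ![hex.choose, w] = η ![hex.choose - u, w] + η ![u, w] := this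
  rw [h2 w hw, h w hw] at h3
  linarith

end Linear

/-! ### Symplectic and contact fibrations -/

section Fibrations

variable {EB : Type*} [NormedAddCommGroup EB] [NormedSpace ℝ EB]
  {B : Type*} [TopologicalSpace B] [ChartedSpace EB B]
  {EM : Type*} [NormedAddCommGroup EM] [NormedSpace ℝ EM]
  {ES : Type*} [NormedAddCommGroup ES] [NormedSpace ℝ ES]
  {S : Type*} [TopologicalSpace S] [ChartedSpace ES S]
  {EX : Type*} [NormedAddCommGroup EX] [NormedSpace ℝ EX]
  {X : Type*} [TopologicalSpace X] [ChartedSpace EX X]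

variable (EB EM ES) in
/-- `p : S → B` is a smooth fibre bundle with typical fibre `M`. -/
def IsSmoothFibreBundle (M : Type*) [TopologicalSpace M] [ChartedSpace EM M] (p : S → B) : Prop :=
  ∀ b : B, ∃ e : Bundle.Trivialization M p, b ∈ e.baseSet ∧
    ContMDiffOn 𝓘(ℝ, ES) (𝓘(ℝ, EB).prod 𝓘(ℝ, EM)) ∞ e e.source ∧
    ContMDiffOn (𝓘(ℝ, EB).prod 𝓘(ℝ, EM)) 𝓘(ℝ, ES) ∞ e.toOpenPartialHomeomorph.symm e.target

variable (EB ES) in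
/-- The vertical tangent space `ker (dp)_x`, i.e. the tangent space at `x` of the fibre of `p`
through `x`. -/
def verticalSpace (p : S → B) (x : S) : Submodule ℝ (TangentSpace 𝓘(ℝ, ES) x) :=
  LinearMap.ker (mfderiv 𝓘(ℝ, ES) 𝓘(ℝ, EB) p x).toLinearMap

variable (EB EM) in
/-- `(p : S → B, Ω)` is a symplectic fibration with typical fibre `M`: a smooth fibre bundle such
that the restriction of the 2-form `Ω` to every fibre is closed and nondegenerate. -/
structure IsSymplecticFibration (M : Type*) [TopologicalSpace M] [ChartedSpace EM M] (p : S → B)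
    (Ω : DiffForm ES S 2) : Prop where
  isSmoothFibreBundle : IsSmoothFibreBundle EB EM ES M p
  closed_on_fibres : ∀ (x : S) (v : Fin 3 → TangentSpace 𝓘(ℝ, ES) x),
    (∀ i, v i ∈ verticalSpace EB ES p x) → Ω.d x v = 0
  nondegenerate_on_fibres : ∀ x : S, NondegenerateOn (Ω x) (verticalSpace EB ES p x)

variable (EB) in
/-- The fibrewise Poisson bracket on the total space of a symplectic fibration: its bivector is the
inverse of `Ω` on the vertical tangent spaces. -/
def fibrewisePoissonBracket (p : S → B) (Ω : DiffForm ES S 2) : (S → ℝ) → (S → ℝ) → S → ℝ :=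
  tensorBracket (fun x => inverseBivector (Ω x) (verticalSpace EB ES p x)) (fun _ => 0)

variable (EB) in
/-- The vertical contact hyperplane `ker (dπ)_x ∩ ker Θ_x`. -/
def verticalContactSpace (π : X → B) (Θ : DiffForm EX X 1) (x : X) :
    Submodule ℝ (TangentSpace 𝓘(ℝ, EX) x) where
  carrier := {v | v ∈ verticalSpace EB EX π x ∧ Θ x ![v] = 0}
  add_mem' := by
    rintro v w ⟨hv, hv'⟩ ⟨hw, hw'⟩
    refine ⟨Submodule.add_mem _ hv hw, ?_⟩
    have h : Θ x ![v + w] = Θ x ![v] + Θ x ![w] :=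
      (Θ x).toAlternatingMap.map_vecCons_add ![] v w
    rw [h, hv', hw', add_zero]
  zero_mem' := ⟨Submodule.zero_mem _, (Θ x).map_coord_zero 0 rfl⟩
  smul_mem' := by
    rintro c v ⟨hv, hv'⟩
    refine ⟨Submodule.smul_mem _ c hv, ?_⟩
    have h : Θ x ![c • v] = c • Θ x ![v] :=
      (Θ x).toAlternatingMap.map_vecCons_smul ![] c v
    rw [h, hv', smul_zero]

variable (EB) in
/-- `Θ` restricts to a contact form on every fibre of `π`: the restriction is nowhere zero, and its
exterior derivative is nondegenerate on its kernel. -/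
def IsFibrewiseContactForm (π : X → B) (Θ : DiffForm EX X 1) : Prop :=
  ∀ x : X, (∃ v ∈ verticalSpace EB EX π x, Θ x ![v] ≠ 0) ∧
    NondegenerateOn (Θ.d x) (verticalContactSpace EB π Θ x)

open Classical in
variable (EB) in
/-- The vertical Reeb field: the vertical `v` with `Θ(v) = 1` and `dΘ(v, w) = 0` for all vertical
`w`. It exists and is unique if `Θ` restricts to contact forms on the fibres. -/
def verticalReeb (π : X → B) (Θ : DiffForm EX X 1) (x : X) : TangentSpace 𝓘(ℝ, EX) x :=
  if h : ∃ v ∈ verticalSpace EB EX π x, Θ x ![v] = 1 ∧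
      ∀ w ∈ verticalSpace EB EX π x, Θ.d x ![v, w] = 0
  then h.choose else 0

variable (EB) in
/-- The fibrewise Jacobi bracket `{f, g} = Λ(df, dg) + f · R g - g · R f` on the total space of a
contact fibration: `Λ` is the inverse of the symplectic form `dΘ` on the vertical contact
hyperplanes, `R` is the vertical Reeb field. -/
def fibrewiseContactBracket (π : X → B) (Θ : DiffForm EX X 1) : (X → ℝ) → (X → ℝ) → X → ℝ :=
  tensorBracket (fun x => inverseBivector (Θ.d x) (verticalContactSpace EB π Θ x))
    (verticalReeb EB π Θ)

/-! ### Principal circle bundles with connection -/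

variable (ES EX) in
/-- `q : X → S` is a smooth principal circle bundle for the given action of the circle on `X`: the
action is smooth and there are smooth equivariant local trivialisations. -/
structure IsPrincipalCircleBundle [MulAction Circle X] (q : X → S) : Prop where
  contMDiff_smul : ContMDiff ((𝓡 1).prod 𝓘(ℝ, EX)) 𝓘(ℝ, EX) ∞ (fun a : Circle × X => a.1 • a.2)
  exists_trivialization : ∀ s : S, ∃ e : Bundle.Trivialization Circle q, s ∈ e.baseSet ∧
    ContMDiffOn 𝓘(ℝ, EX) (𝓘(ℝ, ES).prod (𝓡 1)) ∞ e e.source ∧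
    ContMDiffOn (𝓘(ℝ, ES).prod (𝓡 1)) 𝓘(ℝ, EX) ∞ e.toOpenPartialHomeomorph.symm e.target ∧
    ∀ (z : Circle), ∀ x ∈ e.source, z • x ∈ e.source ∧ e (z • x) = ((e x).1, z * (e x).2)

/-- `Θ` is a connection 1-form for the circle action on `X` (with Lie algebra `ℝ`, the circle being
`ℝ / 2πℤ`): it is invariant, and takes the value `1` on the generator `d/dt|_{t=0} e^{it} • x` of
the action. -/
structure IsConnectionForm [MulAction Circle X] (Θ : DiffForm EX X 1) : Prop where
  invariant : ∀ (z : Circle) (x : X) (v : TangentSpace 𝓘(ℝ, EX) x),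
    Θ (z • x) ![mfderiv 𝓘(ℝ, EX) 𝓘(ℝ, EX) (fun y : X => z • y) x v] = Θ x ![v]
  normalized : ∀ x : X, Θ (Circle.exp 0 • x)
    ![mfderiv 𝓘(ℝ, ℝ) 𝓘(ℝ, EX) (fun t : ℝ => Circle.exp t • x) 0 (1 : ℝ)] = 1

/-- `(q : X → S, Θ)` is a prequantum circle bundle of `(S, Ω)`: a principal circle bundle with a
connection form whose curvature is `Ω`, i.e. `dΘ = q^*Ω`. -/
structure IsPrequantumBundle [MulAction Circle X] (Ω : DiffForm ES S 2) (q : X → S)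
    (Θ : DiffForm EX X 1) : Prop where
  isPrincipal : IsPrincipalCircleBundle ES EX q
  isConnection : IsConnectionForm Θ
  curvature : ∀ x : X,
    Θ.d x = (Ω (q x)).compContinuousLinearMap (mfderiv 𝓘(ℝ, EX) 𝓘(ℝ, ES) q x)

end Fibrations

end

/-!
Both brackets come from Hamiltonian vector fields. On `S` let `V_f = -(df)^♯`; on `X` let `V_f` be the
vertical contact field `f R - (df)^♯`, so that `Θ(V_f) = f`. In both cases

  `{f, g} = V_f g - g R f`   and   `η(V_f, ·) = -df + (R f) Θ` on vertical vectors,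

with `η = Ω`, `R = 0` on `S` and `η = dΘ` on `X`. For such a family the first order Leibniz rule is
immediate, and the Jacobi identity is the vanishing of `dη(V_f, V_g, V_h)`, expanded by the invariant
formula for the exterior derivative (`jacobi_of_hamiltonian`). Two further facts enter: Lie brackets of
vertical fields are vertical, and on `X` the same formula for `dΘ` gives `Θ([V_f, V_g]) = {f, g}`.
`isJacobiBracket_of_hamiltonian` carries this out in the preferred charts, where `formInChart_d`
identifies the exterior derivative with that of the local expression.

Smoothness of the brackets is smoothness of the fields `V_f`. In a chart `V_f` is the solution of a
linear system (prescribed value under a surjection `A`, prescribed values of `η(V_f, ·)` on `ker A`),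
which becomes a square invertible system after a Lagrange multiplier is added
(`contDiffAt_of_lagrangeSystem`); here `A = dp` on `S` and `A = (dπ, Θ)` on `X`.

Finally `q` is a submersion whose vertical spaces are spanned by the generator of the action, on which
`Θ = 1`. So `dq` identifies `ker dπ ∩ ker Θ` with `ker dp`, and `dΘ = q^*Ω` with `Ω`. This shows that `Θ`
is a contact form on the fibres, that `dq(R) = 0`, and that `dq` maps `(d(f ∘ q))^♯` to `(df)^♯`, whence
the two brackets correspond.
-/

/-! ### Alternating forms of low degree -/

section Algebra

variable {T : Type*} [AddCommGroup T] [Module ℝ T] [TopologicalSpace T]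

/-- The linear form on `T` underlying an alternating `1`-form. -/
noncomputable def oneFormLinear (θ : T [⋀^Fin 1]→L[ℝ] ℝ) : T →ₗ[ℝ] ℝ where
  toFun v := θ ![v]
  map_add' v w := θ.toAlternatingMap.map_vecCons_add ![] v w
  map_smul' c v := θ.toAlternatingMap.map_vecCons_smul ![] c v

@[simp]
theorem oneFormLinear_apply (θ : T [⋀^Fin 1]→L[ℝ] ℝ) (v : T) : oneFormLinear θ v = θ ![v] := rfl

theorem twoForm_swap (η : T [⋀^Fin 2]→L[ℝ] ℝ) (u v : T) : η ![u, v] = - η ![v, u] := by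
  have h := η.toAlternatingMap.map_swap ![v, u] (i := 0) (j := 1) (by decide)
  have h2 : (![v, u] ∘ Equiv.swap (0 : Fin 2) 1) = ![u, v] := by
    ext i; fin_cases i <;> simp
  rw [h2] at h
  exact h

theorem twoForm_self (η : T [⋀^Fin 2]→L[ℝ] ℝ) (u : T) : η ![u, u] = 0 := by
  have := twoForm_swap η u u
  linarith

/-- The bilinear form on `T` underlying an alternating `2`-form. -/
noncomputable def twoFormBilin (η : T [⋀^Fin 2]→L[ℝ] ℝ) : T →ₗ[ℝ] T →ₗ[ℝ] ℝ :=
  have hadd : ∀ u u' v, η ![u + u', v] = η ![u, v] + η ![u', v] := fun u u' v =>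
    η.toAlternatingMap.map_vecCons_add ![v] u u'
  have hsmul : ∀ (c : ℝ) (u v), η ![c • u, v] = c • η ![u, v] := fun c u v =>
    η.toAlternatingMap.map_vecCons_smul ![v] c u
  LinearMap.mk₂ ℝ (fun u v => η ![u, v]) hadd hsmul
    (fun u v v' => by
      rw [twoForm_swap, hadd, twoForm_swap η u v, twoForm_swap η u v']; ring)
    (fun c u v => by
      rw [twoForm_swap, hsmul, twoForm_swap η u v, smul_neg])

@[simp]
theorem twoFormBilin_apply (η : T [⋀^Fin 2]→L[ℝ] ℝ) (u v : T) :
    twoFormBilin η u v = η ![u, v] := rfl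

/-- A `2`-form which is nondegenerate on a subspace `W` of a finite-dimensional space represents
every linear form on `W`. -/
theorem NondegenerateOn.exists_eq [FiniteDimensional ℝ T] {η : T [⋀^Fin 2]→L[ℝ] ℝ}
    {W : Submodule ℝ T} (hη : NondegenerateOn η W) (α : T →ₗ[ℝ] ℝ) :
    ∃ u ∈ W, ∀ w ∈ W, η ![u, w] = α w := by
  let b : W →ₗ[ℝ] Module.Dual ℝ W := (twoFormBilin η).domRestrict₁₂ W W
  have hinj : Function.Injective b := by
    rw [injective_iff_map_eq_zero]
    intro u hu
    exact Subtype.ext (hη u u.2 fun w hw => LinearMap.congr_fun hu ⟨w, hw⟩)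
  have hsurj : Function.Surjective b :=
    (LinearMap.injective_iff_surjective_of_finrank_eq_finrank
      (Subspace.dual_finrank_eq (K := ℝ) (V := W)).symm).1 hinj
  obtain ⟨u, hu⟩ := hsurj (α ∘ₗ W.subtype)
  exact ⟨u, u.2, fun w hw => LinearMap.congr_fun hu ⟨w, hw⟩⟩

theorem sharp_mem [FiniteDimensional ℝ T] {η : T [⋀^Fin 2]→L[ℝ] ℝ}
    {W : Submodule ℝ T} (hη : NondegenerateOn η W) (α : T →L[ℝ] ℝ) : sharp η W α ∈ W := by
  obtain ⟨u, hu, h⟩ := hη.exists_eq α.toLinearMap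
  rwa [sharp_eq hη hu h]

theorem apply_sharp [FiniteDimensional ℝ T] {η : T [⋀^Fin 2]→L[ℝ] ℝ}
    {W : Submodule ℝ T} (hη : NondegenerateOn η W) (α : T →L[ℝ] ℝ) {w : T} (hw : w ∈ W) :
    η ![sharp η W α, w] = α w := by
  obtain ⟨u, hu, h⟩ := hη.exists_eq α.toLinearMap
  rw [sharp_eq hη hu h]
  exact h w hw

theorem inverseBivector_swap (η : T [⋀^Fin 2]→L[ℝ] ℝ) (W : Submodule ℝ T) (α β : T →L[ℝ] ℝ) :
    inverseBivector η W α β = - inverseBivector η W β α :=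
  twoForm_swap _ _ _

theorem inverseBivector_eq [FiniteDimensional ℝ T] {η : T [⋀^Fin 2]→L[ℝ] ℝ}
    {W : Submodule ℝ T} (hη : NondegenerateOn η W) (α β : T →L[ℝ] ℝ) :
    inverseBivector η W α β = - β (sharp η W α) := by
  rw [inverseBivector, twoForm_swap, apply_sharp hη β (sharp_mem hη α)]

end Algebra

/-! ### Smooth dependence of the solution of a nondegenerate linear system -/

section Smooth

variable {E : Type*} [NormedAddCommGroup E] [NormedSpace ℝ E]
  {F : Type*} [NormedAddCommGroup F] [NormedSpace ℝ F]

variable (E) in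
/-- The identification of alternating `1`-forms with continuous linear forms, as a continuous linear
map. -/
noncomputable def oneFormCLM : (E [⋀^Fin 1]→L[ℝ] ℝ) →L[ℝ] (E →L[ℝ] ℝ) :=
  (ContinuousMultilinearMap.ofSubsingletonₗᵢ (𝕜 := ℝ) (G := E) (G' := ℝ)
    (0 : Fin 1)).symm.toContinuousLinearEquiv.toContinuousLinearMap ∘L
    ContinuousAlternatingMap.toContinuousMultilinearMapCLM ℝ

@[simp]
theorem oneFormCLM_apply (θ : E [⋀^Fin 1]→L[ℝ] ℝ) (v : E) : oneFormCLM E θ v = θ ![v] := by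
  change θ (fun _ => v) = _
  congr 1
  ext i; fin_cases i; rfl

variable (E) in
/-- The map sending a `2`-form `η` to `η^♭ : u ↦ η(u, ·)`, as a continuous linear map. -/
noncomputable def flatCLM : (E [⋀^Fin 2]→L[ℝ] ℝ) →L[ℝ] (E →L[ℝ] E →L[ℝ] ℝ) :=
  (ContinuousLinearMap.compL ℝ E (E [⋀^Fin 1]→L[ℝ] ℝ) (E →L[ℝ] ℝ) (oneFormCLM E)) ∘L
    ContinuousAlternatingMap.curryLeftLI.toContinuousLinearMap

@[simp]
theorem flatCLM_apply (η : E [⋀^Fin 2]→L[ℝ] ℝ) (u v : E) : flatCLM E η u v = η ![u, v] := by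
  change oneFormCLM E (η.curryLeft u) v = _
  simp

/-- The linear system `(u, μ) ↦ (η(u, ·) + μ ∘ A, A u)`: the equations `A u = c` and `η(u, w) = α(w)`
for all `w ∈ ker A`, with a Lagrange multiplier `μ`. -/
noncomputable def lagrangeSystem (η : E [⋀^Fin 2]→L[ℝ] ℝ) (A : E →L[ℝ] F) :
    E × (F →L[ℝ] ℝ) →L[ℝ] (E →L[ℝ] ℝ) × F :=
  ((flatCLM E η).coprod ((ContinuousLinearMap.compL ℝ E F ℝ).flip A)).prod
    (A ∘L ContinuousLinearMap.fst ℝ E (F →L[ℝ] ℝ))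

theorem lagrangeSystem_apply (η : E [⋀^Fin 2]→L[ℝ] ℝ) (A : E →L[ℝ] F) (u : E) (μ : F →L[ℝ] ℝ) :
    lagrangeSystem η A (u, μ) = (flatCLM E η u + μ ∘L A, A u) := rfl

theorem isInvertible_lagrangeSystem [FiniteDimensional ℝ E] [FiniteDimensional ℝ F]
    {η : E [⋀^Fin 2]→L[ℝ] ℝ} {A : E →L[ℝ] F} (hA : Function.Surjective A)
    (hη : NondegenerateOn η (LinearMap.ker A.toLinearMap)) :
    (lagrangeSystem η A).IsInvertible := by
  have hinj : Function.Injective (lagrangeSystem η A).toLinearMap := by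
    rw [injective_iff_map_eq_zero]
    rintro ⟨u, μ⟩ h
    obtain ⟨h1, h2⟩ : flatCLM E η u + μ ∘L A = 0 ∧ A u = 0 := by
      simpa [lagrangeSystem_apply] using h
    have hu : u = 0 := hη u h2 fun w hw => by
      have := DFunLike.congr_fun h1 w
      have hw' : A w = 0 := hw
      simpa [hw'] using this
    subst hu
    have hμ : μ = 0 := by
      ext c
      obtain ⟨v, rfl⟩ := hA c
      simpa using DFunLike.congr_fun h1 v
    rw [hμ]; rfl
  have hdim : Module.finrank ℝ (E × (F →L[ℝ] ℝ)) = Module.finrank ℝ ((E →L[ℝ] ℝ) × F) := by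
    rw [Module.finrank_prod, Module.finrank_prod,
      (LinearEquiv.finrank_eq (LinearMap.toContinuousLinearMap (E := E) (F' := ℝ) (𝕜 := ℝ))).symm,
      (LinearEquiv.finrank_eq (LinearMap.toContinuousLinearMap (E := F) (F' := ℝ) (𝕜 := ℝ))).symm]
    congr 1
    · exact (Subspace.dual_finrank_eq (K := ℝ) (V := E)).symm
    · exact Subspace.dual_finrank_eq (K := ℝ) (V := F)
  exact ⟨(LinearEquiv.ofInjectiveOfFinrankEq (lagrangeSystem η A).toLinearMap hinj
    hdim).toContinuousLinearEquiv, by ext <;> rfl⟩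

/-- A field `V` which solves the equations `A V = c` and `η(V, w) = α(w)` for `w ∈ ker A` is smooth
if the coefficients are, provided that `A` is onto and `η` is nondegenerate on `ker A`. -/
theorem contDiffAt_of_lagrangeSystem [FiniteDimensional ℝ E] [FiniteDimensional ℝ F]
    {n : WithTop ℕ∞} {y₀ : E} {η : E → E [⋀^Fin 2]→L[ℝ] ℝ} {A : E → E →L[ℝ] F}
    {α : E → E →L[ℝ] ℝ} {c : E → F} {V : E → E}
    (hη : ContDiffAt ℝ n η y₀) (hA : ContDiffAt ℝ n A y₀) (hα : ContDiffAt ℝ n α y₀)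
    (hc : ContDiffAt ℝ n c y₀)
    (hsurj : ∀ᶠ y in nhds y₀, Function.Surjective (A y))
    (hnd : ∀ᶠ y in nhds y₀, NondegenerateOn (η y) (LinearMap.ker (A y).toLinearMap))
    (hV : ∀ᶠ y in nhds y₀, A y (V y) = c y ∧ ∀ w, A y w = 0 → η y ![V y, w] = α y w) :
    ContDiffAt ℝ n V y₀ := by
  have hL : ContDiffAt ℝ n (fun y => lagrangeSystem (η y) (A y)) y₀ := by
    have h1 : ContDiffAt ℝ n (fun y => flatCLM E (η y)) y₀ := by fun_prop
    have h2 : ContDiffAt ℝ n (fun y => (ContinuousLinearMap.compL ℝ E F ℝ).flip (A y)) y₀ := by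
      fun_prop
    have h3 : (fun y => lagrangeSystem (η y) (A y)) = fun y =>
        (ContinuousLinearMap.inl ℝ (E →L[ℝ] ℝ) F ∘L
          (flatCLM E (η y) ∘L ContinuousLinearMap.fst ℝ E (F →L[ℝ] ℝ) +
            (ContinuousLinearMap.compL ℝ E F ℝ).flip (A y) ∘L
              ContinuousLinearMap.snd ℝ E (F →L[ℝ] ℝ))) +
        (ContinuousLinearMap.inr ℝ (E →L[ℝ] ℝ) F ∘L
          (A y ∘L ContinuousLinearMap.fst ℝ E (F →L[ℝ] ℝ))) := by
      funext y
      refine ContinuousLinearMap.ext fun ⟨u, μ⟩ => ?_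
      rw [lagrangeSystem_apply]
      simp
    rw [h3]
    exact (contDiffAt_const.clm_comp ((h1.clm_comp contDiffAt_const).add
      (h2.clm_comp contDiffAt_const))).add
        (contDiffAt_const.clm_comp (hA.clm_comp contDiffAt_const))
  have hinv : ContDiffAt ℝ n ContinuousLinearMap.inverse (lagrangeSystem (η y₀) (A y₀)) :=
    (isInvertible_lagrangeSystem hsurj.self_of_nhds hnd.self_of_nhds).contDiffAt_map_inverse
  have hsol : ContDiffAt ℝ n
      (fun y => ((lagrangeSystem (η y) (A y)).inverse (α y, c y)).1) y₀ :=
    ((ContDiffAt.comp (g := ContinuousLinearMap.inverse) y₀ hinv hL).clm_apply (hα.prodMk hc)).fst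
  refine hsol.congr_of_eventuallyEq ?_
  filter_upwards [hsurj, hnd, hV] with y h1 h2 ⟨h3, h4⟩
  obtain ⟨Φ, hΦ⟩ := isInvertible_lagrangeSystem h1 h2
  rw [← hΦ, ContinuousLinearMap.inverse_equiv]
  obtain ⟨⟨u, μ⟩, hu⟩ : ∃ z, Φ z = (α y, c y) := Φ.surjective _
  have hu' : lagrangeSystem (η y) (A y) (u, μ) = (α y, c y) := by rw [← hΦ]; exact hu
  obtain ⟨h5, h6⟩ := Prod.ext_iff.1 hu'
  rw [lagrangeSystem_apply] at h5 h6
  change flatCLM E (η y) u + μ ∘L A y = α y at h5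
  change A y u = c y at h6
  have : V y = u := by
    rw [← sub_eq_zero]
    refine h2 _ ?_ fun w hw => ?_
    · change A y (V y - u) = 0
      rw [map_sub, h3, h6, sub_self]
    · have hw' : A y w = 0 := hw
      have h7 := DFunLike.congr_fun h5 w
      have h8 : η y ![u, w] = α y w := by simpa [hw'] using h7
      have h9 := LinearMap.map_sub₂ (twoFormBilin (η y)) (V y) u w
      simp only [twoFormBilin_apply] at h9
      rw [h9, h8, h4 w hw', sub_self]
  rw [← hu]
  simp [this]

end Smooth

/-! ### The Jacobi identity for Hamiltonian vector fields -/

section LocalJacobi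

open VectorField

variable {E : Type*} [NormedAddCommGroup E] [NormedSpace ℝ E]

theorem extDeriv_oneForm_apply_vectorField {θ : E → E [⋀^Fin 1]→L[ℝ] ℝ} {U V : E → E} {y : E}
    (hθ : DifferentiableAt ℝ θ y) (hU : DifferentiableAt ℝ U y) (hV : DifferentiableAt ℝ V y) :
    extDeriv θ y ![U y, V y] =
      fderiv ℝ (fun z => θ z ![V z]) y (U y) - fderiv ℝ (fun z => θ z ![U z]) y (V y)
        - θ y ![lieBracket ℝ U V y] := by
  have h := extDeriv_apply_vectorField (V := ![U, V]) hθ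
    (fun i => by fin_cases i <;> simpa)
  have e1 : (fun i : Fin 2 => (![U, V] : Fin 2 → E → E) i y) = ![U y, V y] := by
    ext i; fin_cases i <;> rfl
  have e2 : (fun z => θ z (Fin.removeNth 0 fun i : Fin 2 => (![U, V] : Fin 2 → E → E) i z)) =
      fun z => θ z ![V z] := by
    ext z; congr 1; ext i; fin_cases i; rfl
  have e3 : (fun z => θ z (Fin.removeNth 1 fun i : Fin 2 => (![U, V] : Fin 2 → E → E) i z)) =
      fun z => θ z ![U z] := by
    ext z; congr 1; ext i; fin_cases i; rfl
  rw [e1] at h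
  rw [h, Fin.sum_univ_two, e2, e3]
  simp [sub_eq_add_neg]

theorem extDeriv_twoForm_apply_vectorField {η : E → E [⋀^Fin 2]→L[ℝ] ℝ} {U V W : E → E} {y : E}
    (hη : DifferentiableAt ℝ η y) (hU : DifferentiableAt ℝ U y) (hV : DifferentiableAt ℝ V y)
    (hW : DifferentiableAt ℝ W y) :
    extDeriv η y ![U y, V y, W y] =
      fderiv ℝ (fun z => η z ![V z, W z]) y (U y) + fderiv ℝ (fun z => η z ![W z, U z]) y (V y)
        + fderiv ℝ (fun z => η z ![U z, V z]) y (W y)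
        + η y ![W y, lieBracket ℝ U V y] + η y ![U y, lieBracket ℝ V W y]
        + η y ![V y, lieBracket ℝ W U y] := by
  have h := extDeriv_apply_vectorField (V := ![U, V, W]) hη
    (fun i => by fin_cases i <;> simpa)
  have e1 : (fun i : Fin 3 => (![U, V, W] : Fin 3 → E → E) i y) = ![U y, V y, W y] := by
    ext i; fin_cases i <;> rfl
  have r (a b : E → E) (i : Fin 3) (h0 : (![U, V, W] : Fin 3 → E → E) (i.succAbove 0) = a)
      (h1 : (![U, V, W] : Fin 3 → E → E) (i.succAbove 1) = b) (z : E) :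
      i.removeNth (fun k : Fin 3 => (![U, V, W] : Fin 3 → E → E) k z) = ![a z, b z] := by
    ext k; fin_cases k
    · exact congrFun h0 z
    · exact congrFun h1 z
  have r0 := r V W 0 rfl rfl
  have r1 := r U W 1 rfl rfl
  have r2 := r U V 2 rfl rfl
  have l0 : Fin.removeNth (0 : Fin 2) (Fin.removeNth (Fin.castSucc (0 : Fin 2)) ![U y, V y, W y]) =
      ![W y] := by ext k; fin_cases k; rfl
  have l1 : Fin.removeNth (1 : Fin 2) (Fin.removeNth (Fin.castSucc (0 : Fin 2)) ![U y, V y, W y]) =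
      ![V y] := by ext k; fin_cases k; rfl
  have l2 : Fin.removeNth (1 : Fin 2) (Fin.removeNth (Fin.castSucc (1 : Fin 2)) ![U y, V y, W y]) =
      ![U y] := by ext k; fin_cases k; rfl
  have f1 : (fun z => η z ![W z, U z]) = fun z => -η z ![U z, W z] :=
    funext fun z => twoForm_swap _ _ _
  have f2 : η y ![V y, lieBracket ℝ W U y] = η y ![lieBracket ℝ U W y, V y] := by
    rw [lieBracket_swap, ← twoFormBilin_apply, map_neg, twoFormBilin_apply, twoForm_swap, neg_neg]
  rw [e1, Fin.sum_univ_three, Fin.sum_univ_two, show (Finset.Ici (0 : Fin 2)) = {0, 1} by decide,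
    show (Finset.Ici (1 : Fin 2)) = {1} by decide, Finset.sum_pair (by decide),
    Finset.sum_singleton, l0, l1, l2] at h
  simp only [r0, r1, r2] at h
  rw [h, f1, fderiv_fun_neg, twoForm_swap _ (W y), twoForm_swap _ (U y) (lieBracket ℝ V W y), f2]
  simp
  ring

/-- Let `U`, `V`, `W` be the Hamiltonian vector fields of `f`, `g`, `h` for a closed `2`-form `η`, in
the generalised sense that `η(V_f, ·) = -df + r_f θ` with `r_f θ(V_g) = r_f g`, where `b_fg` stands for
the bracket `V_f g - g r_f`. Evaluating `dη = 0` on the three fields yields the Jacobi identity. -/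
theorem jacobi_of_hamiltonian {η : E → E [⋀^Fin 2]→L[ℝ] ℝ} {U V W : E → E}
    {f g h bfg bgh bhf : E → ℝ} {rf rg rh : ℝ} {y : E}
    (hη : DifferentiableAt ℝ η y) (hd : extDeriv η y = 0)
    (hU : DifferentiableAt ℝ U y) (hV : DifferentiableAt ℝ V y) (hW : DifferentiableAt ℝ W y)
    (hf : ContDiffAt ℝ 2 f y) (hg : ContDiffAt ℝ 2 g y) (hh : ContDiffAt ℝ 2 h y)
    (hbfg : DifferentiableAt ℝ bfg y) (hbgh : DifferentiableAt ℝ bgh y)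
    (hbhf : DifferentiableAt ℝ bhf y)
    (hUV : ∀ᶠ z in nhds y, η z ![U z, V z] = fderiv ℝ g z (U z) - fderiv ℝ f z (V z) - bfg z)
    (hVW : ∀ᶠ z in nhds y, η z ![V z, W z] = fderiv ℝ h z (V z) - fderiv ℝ g z (W z) - bgh z)
    (hWU : ∀ᶠ z in nhds y, η z ![W z, U z] = fderiv ℝ f z (W z) - fderiv ℝ h z (U z) - bhf z)
    (hW' : η y ![W y, lieBracket ℝ U V y] = - fderiv ℝ h y (lieBracket ℝ U V y) + rh * bfg y)
    (hU' : η y ![U y, lieBracket ℝ V W y] = - fderiv ℝ f y (lieBracket ℝ V W y) + rf * bgh y)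
    (hV' : η y ![V y, lieBracket ℝ W U y] = - fderiv ℝ g y (lieBracket ℝ W U y) + rg * bhf y) :
    (fderiv ℝ bgh y (U y) - bgh y * rf) + (fderiv ℝ bhf y (V y) - bhf y * rg)
      + (fderiv ℝ bfg y (W y) - bfg y * rh) = 0 := by
  have hdiff {k : E → ℝ} (hk : ContDiffAt ℝ 2 k y) {Z : E → E} (hZ : DifferentiableAt ℝ Z y) :
      DifferentiableAt ℝ (fun z => fderiv ℝ k z (Z z)) y :=
    ((hk.fderiv_right (m := 1) (by norm_num)).differentiableAt one_ne_zero).clm_apply hZ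
  have key {k l b : E → ℝ} {Y Z : E → E} (hk : ContDiffAt ℝ 2 k y) (hl : ContDiffAt ℝ 2 l y)
      (hY : DifferentiableAt ℝ Y y) (hZ : DifferentiableAt ℝ Z y) (hb : DifferentiableAt ℝ b y)
      (H : ∀ᶠ z in nhds y, η z ![Y z, Z z] = fderiv ℝ l z (Y z) - fderiv ℝ k z (Z z) - b z) (v : E) :
      fderiv ℝ (fun z => η z ![Y z, Z z]) y v = fderiv ℝ (fun z => fderiv ℝ l z (Y z)) y v
        - fderiv ℝ (fun z => fderiv ℝ k z (Z z)) y v - fderiv ℝ b y v := by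
    have H' : (fun z => η z ![Y z, Z z]) =ᶠ[nhds y]
      fun z => fderiv ℝ l z (Y z) - fderiv ℝ k z (Z z) - b z := H
    rw [H'.fderiv_eq, fderiv_fun_sub ((hdiff hl hY).fun_sub (hdiff hk hZ)) hb,
      fderiv_fun_sub (hdiff hl hY) (hdiff hk hZ)]
    rfl
  have hs : minSmoothness ℝ 2 ≤ (2 : WithTop ℕ∞) := by simp
  have h0 := extDeriv_twoForm_apply_vectorField hη hU hV hW
  rw [hd, key hf hg hU hV hbfg hUV, key hg hh hV hW hbgh hVW, key hh hf hW hU hbhf hWU, hW', hU', hV',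
    fderiv_apply_lieBracket hh hs hV hU, fderiv_apply_lieBracket hf hs hW hV,
    fderiv_apply_lieBracket hg hs hU hW] at h0
  have hz : (0 : E [⋀^Fin 3]→L[ℝ] ℝ) ![U y, V y, W y] = 0 := rfl
  rw [hz] at h0
  linarith

end LocalJacobi

/-! ### Expressions in charts -/

section Charts

open Topology

variable {E : Type*} [NormedAddCommGroup E] [NormedSpace ℝ E]
  {M : Type*} [TopologicalSpace M] [ChartedSpace E M]
  {F : Type*} [NormedAddCommGroup F] [NormedSpace ℝ F]
  {N : Type*} [TopologicalSpace N] [ChartedSpace F N] 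

theorem formInChart_one_apply (θ : ∀ x : M, TangentSpace 𝓘(ℝ, E) x [⋀^Fin 1]→L[ℝ] ℝ) (x₀ : M)
    (y u : E) :
    formInChart θ x₀ y ![u] =
      θ ((extChartAt 𝓘(ℝ, E) x₀).symm y) ![chartSymmDeriv x₀ y u] := by
  change θ _ _ = _
  congr 1
  ext i; fin_cases i; rfl

theorem formInChart_two_apply (η : ∀ x : M, TangentSpace 𝓘(ℝ, E) x [⋀^Fin 2]→L[ℝ] ℝ) (x₀ : M)
    (y u v : E) :
    formInChart η x₀ y ![u, v] =
      η ((extChartAt 𝓘(ℝ, E) x₀).symm y) ![chartSymmDeriv x₀ y u, chartSymmDeriv x₀ y v] := by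
  change η _ _ = _
  congr 1
  ext i; fin_cases i <;> rfl

theorem two_le_infty : minSmoothness ℝ 2 ≤ (∞ : WithTop ℕ∞) := by
  rw [minSmoothness_of_isRCLikeNormedField]
  exact WithTop.coe_le_coe.2 (le_top : (2 : ℕ∞) ≤ ⊤)

theorem contMDiffAt_of_contDiffAt_chart {f : M → F} {n : WithTop ℕ∞} (hn : n ≤ ∞) {x₀ : M}
    (hf : ContDiffAt ℝ n (f ∘ (extChartAt 𝓘(ℝ, E) x₀).symm) (extChartAt 𝓘(ℝ, E) x₀ x₀)) :
    ContMDiffAt 𝓘(ℝ, E) 𝓘(ℝ, F) n f x₀ := by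
  have h := ContMDiffAt.comp x₀ hf.contMDiffAt ((contMDiffAt_extChartAt (n := ∞) (x := x₀)).of_le hn)
  refine h.congr_of_eventuallyEq ?_
  filter_upwards [extChartAt_source_mem_nhds (I := 𝓘(ℝ, E)) x₀] with x hx
  simp only [Function.comp_apply, (extChartAt 𝓘(ℝ, E) x₀).left_inv hx]

variable [IsManifold 𝓘(ℝ, E) ∞ M]

theorem mdifferentiableAt_extChartAt_symm {x₀ : M} {y : E}
    (hy : y ∈ (extChartAt 𝓘(ℝ, E) x₀).target) :
    MDifferentiableAt 𝓘(ℝ, E) 𝓘(ℝ, E) (extChartAt 𝓘(ℝ, E) x₀).symm y :=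
  ((contMDiffOn_extChartAt_symm (n := ∞) x₀).contMDiffAt
    (extChartAt_target_mem_nhds' hy)).mdifferentiableAt (by simp)

theorem chartSymmDeriv_mfderiv {x₀ : M} {y : E} (hy : y ∈ (extChartAt 𝓘(ℝ, E) x₀).target)
    (v : TangentSpace 𝓘(ℝ, E) ((extChartAt 𝓘(ℝ, E) x₀).symm y)) :
    chartSymmDeriv x₀ y (mfderiv 𝓘(ℝ, E) 𝓘(ℝ, E) (extChartAt 𝓘(ℝ, E) x₀)
      ((extChartAt 𝓘(ℝ, E) x₀).symm y) v) = v := by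
  have h := mfderivWithin_extChartAt_symm_comp_mfderiv_extChartAt (I := 𝓘(ℝ, E)) hy
  rw [ModelWithCorners.range_eq_univ, mfderivWithin_univ] at h
  exact DFunLike.congr_fun h v

theorem mfderiv_chartSymmDeriv {x₀ : M} {y : E} (hy : y ∈ (extChartAt 𝓘(ℝ, E) x₀).target)
    (v : E) :
    mfderiv 𝓘(ℝ, E) 𝓘(ℝ, E) (extChartAt 𝓘(ℝ, E) x₀)
      ((extChartAt 𝓘(ℝ, E) x₀).symm y) (chartSymmDeriv x₀ y v) = v := by
  have h := mfderiv_extChartAt_comp_mfderivWithin_extChartAt_symm (I := 𝓘(ℝ, E)) hy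
  rw [ModelWithCorners.range_eq_univ, mfderivWithin_univ] at h
  exact DFunLike.congr_fun h v

theorem surjective_chartSymmDeriv {x₀ : M} {y : E} (hy : y ∈ (extChartAt 𝓘(ℝ, E) x₀).target) :
    Function.Surjective (chartSymmDeriv x₀ y) := fun v =>
  ⟨_, chartSymmDeriv_mfderiv hy v⟩

/-- The expression of a vector field in the preferred chart around `x₀`. -/
noncomputable def fieldInChart (V : ∀ x : M, TangentSpace 𝓘(ℝ, E) x) (x₀ : M) (y : E) : E :=
  mfderiv 𝓘(ℝ, E) 𝓘(ℝ, E) (extChartAt 𝓘(ℝ, E) x₀) ((extChartAt 𝓘(ℝ, E) x₀).symm y)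
    (V ((extChartAt 𝓘(ℝ, E) x₀).symm y))

theorem chartSymmDeriv_fieldInChart (V : ∀ x : M, TangentSpace 𝓘(ℝ, E) x) {x₀ : M} {y : E}
    (hy : y ∈ (extChartAt 𝓘(ℝ, E) x₀).target) :
    chartSymmDeriv x₀ y (fieldInChart V x₀ y) = V ((extChartAt 𝓘(ℝ, E) x₀).symm y) :=
  chartSymmDeriv_mfderiv hy _

theorem contDiffAt_comp_extChartAt_symm {f : M → F} {n : WithTop ℕ∞} (hn : n ≤ ∞) {x₀ : M} {y : E}
    (hy : y ∈ (extChartAt 𝓘(ℝ, E) x₀).target)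
    (hf : ContMDiffAt 𝓘(ℝ, E) 𝓘(ℝ, F) n f ((extChartAt 𝓘(ℝ, E) x₀).symm y)) :
    ContDiffAt ℝ n (f ∘ (extChartAt 𝓘(ℝ, E) x₀).symm) y :=
  (hf.comp y (((contMDiffOn_extChartAt_symm (n := ∞) x₀).contMDiffAt
    (extChartAt_target_mem_nhds' hy)).of_le hn)).contDiffAt

theorem fderiv_comp_extChartAt_symm {f : M → F} {x₀ : M} {y : E}
    (hy : y ∈ (extChartAt 𝓘(ℝ, E) x₀).target)
    (hf : MDifferentiableAt 𝓘(ℝ, E) 𝓘(ℝ, F) f ((extChartAt 𝓘(ℝ, E) x₀).symm y)) (v : E) :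
    fderiv ℝ (f ∘ (extChartAt 𝓘(ℝ, E) x₀).symm) y v =
      mfderiv 𝓘(ℝ, E) 𝓘(ℝ, F) f ((extChartAt 𝓘(ℝ, E) x₀).symm y) (chartSymmDeriv x₀ y v) := by
  rw [← mfderiv_eq_fderiv, mfderiv_comp y hf (mdifferentiableAt_extChartAt_symm hy)]
  rfl

theorem formInChart_mfderiv {k : ℕ} (η : ∀ x : M, TangentSpace 𝓘(ℝ, E) x [⋀^Fin k]→L[ℝ] ℝ)
    {x₀ x : M} (hx : x ∈ (extChartAt 𝓘(ℝ, E) x₀).source) (v : Fin k → TangentSpace 𝓘(ℝ, E) x) :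
    formInChart η x₀ (extChartAt 𝓘(ℝ, E) x₀ x)
      (fun i => mfderiv 𝓘(ℝ, E) 𝓘(ℝ, E) (extChartAt 𝓘(ℝ, E) x₀) x (v i)) = η x v := by
  obtain ⟨y, hy, rfl⟩ : ∃ y ∈ (extChartAt 𝓘(ℝ, E) x₀).target, (extChartAt 𝓘(ℝ, E) x₀).symm y = x :=
    ⟨_, (extChartAt 𝓘(ℝ, E) x₀).map_source hx, (extChartAt 𝓘(ℝ, E) x₀).left_inv hx⟩
  rw [(extChartAt 𝓘(ℝ, E) x₀).right_inv hy]
  change η _ _ = _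
  congr 1
  ext i
  exact chartSymmDeriv_mfderiv hy (v i)

/-- The exterior derivative, defined through the preferred chart at each point, is given by the
exterior derivative of the expression of the form in any preferred chart. -/
theorem formInChart_d {k : ℕ} (η : DiffForm E M k) {x₀ : M} {y : E}
    (hy : y ∈ (extChartAt 𝓘(ℝ, E) x₀).target) :
    formInChart η.d x₀ y = extDeriv (formInChart η.toFun x₀) y := by
  let e := extChartAt 𝓘(ℝ, E) x₀
  let e' := extChartAt 𝓘(ℝ, E) (e.symm y)
  have hτ : ContDiffAt ℝ ∞ (e' ∘ e.symm) y :=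
    contDiffAt_comp_extChartAt_symm le_rfl hy contMDiffAt_extChartAt
  have hsm : DifferentiableAt ℝ (formInChart η.toFun (e.symm y)) ((e' ∘ e.symm) y) :=
    ((η.smooth' _).contDiffAt (extChartAt_target_mem_nhds _)).differentiableAt (by simp)
  have hpull := extDeriv_pullback hsm hτ two_le_infty
  have hev : formInChart η.toFun x₀ =ᶠ[𝓝 y] fun z =>
      (formInChart η.toFun (e.symm y) ((e' ∘ e.symm) z)).compContinuousLinearMap
        (fderiv ℝ (e' ∘ e.symm) z) := by
    have hc : ∀ᶠ z in 𝓝 y, e.symm z ∈ e'.source :=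
      (mdifferentiableAt_extChartAt_symm hy).continuousAt (extChartAt_source_mem_nhds _)
    filter_upwards [hc, extChartAt_target_mem_nhds' hy] with z hz hzt
    ext v
    refine Eq.trans (formInChart_mfderiv η.toFun hz fun i => chartSymmDeriv x₀ z (v i)).symm ?_
    change _ = formInChart η.toFun (e.symm y) (e' (e.symm z)) _
    congr 1
    ext i
    exact (fderiv_comp_extChartAt_symm hzt
      (mdifferentiableAt_extChartAt (by rwa [← extChartAt_source 𝓘(ℝ, E)])) (v i)).symm
  rw [hev.extDeriv_eq, hpull]
  ext v
  change extDeriv (formInChart η.toFun (e.symm y)) (e' (e.symm y)) _ = 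
    extDeriv (formInChart η.toFun (e.symm y)) (e' (e.symm y)) _
  congr 1
  ext i
  exact (fderiv_comp_extChartAt_symm hy
    (mdifferentiableAt_extChartAt (mem_chart_source E _)) (v i)).symm

/-- The exterior derivative of a smooth form, as a smooth form. -/
noncomputable def DiffForm.extDiff {k : ℕ} (η : DiffForm E M k) : DiffForm E M (k + 1) where
  toFun := η.d
  smooth' x₀ := by
    refine ContDiffOn.congr (f := extDeriv (formInChart η.toFun x₀)) (fun y hy => ?_)
      fun y hy => formInChart_d η hy
    have h := (η.smooth' x₀).contDiffAt (extChartAt_target_mem_nhds' hy)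
    have h' := h.fderiv_right (m := ∞) (by simp)
    exact ((ContinuousAlternatingMap.alternatizeUncurryFinCLM ℝ E ℝ).contDiff.contDiffAt.comp y
      h').contDiffWithinAt

theorem DiffForm.extDeriv_formInChart_eq_zero {k : ℕ} {η : DiffForm E M k} (hη : η.IsClosed)
    {x₀ : M} {y : E} (hy : y ∈ (extChartAt 𝓘(ℝ, E) x₀).target) :
    extDeriv (formInChart η.toFun x₀) y = 0 := by
  rw [← formInChart_d η hy]
  ext v
  exact DFunLike.congr_fun (hη ((extChartAt 𝓘(ℝ, E) x₀).symm y)) _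

theorem DiffForm.isClosed_extDiff {k : ℕ} (η : DiffForm E M k) : η.extDiff.IsClosed := by
  intro x
  have hev : formInChart η.extDiff.toFun x =ᶠ[𝓝 (extChartAt 𝓘(ℝ, E) x x)]
      extDeriv (formInChart η.toFun x) := by
    filter_upwards [extChartAt_target_mem_nhds (I := 𝓘(ℝ, E)) x] with y hy
    exact formInChart_d η hy
  rw [DiffForm.d, hev.extDeriv_eq, extDeriv_extDeriv_apply
    ((η.smooth' x).contDiffAt (extChartAt_target_mem_nhds x)) two_le_infty]
  rfl

end Charts

/-! ### Vertical vectors in charts -/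

section Vertical

open Topology

variable {EB : Type*} [NormedAddCommGroup EB] [NormedSpace ℝ EB]
  {B : Type*} [TopologicalSpace B] [ChartedSpace EB B]
  {E : Type*} [NormedAddCommGroup E] [NormedSpace ℝ E]
  {M : Type*} [TopologicalSpace M] [ChartedSpace E M] [IsManifold 𝓘(ℝ, E) ∞ M]

theorem NondegenerateOn.formInChart {η : ∀ x : M, TangentSpace 𝓘(ℝ, E) x [⋀^Fin 2]→L[ℝ] ℝ}
    {x₀ : M} {y : E} (hy : y ∈ (extChartAt 𝓘(ℝ, E) x₀).target)
    {W : Submodule ℝ (TangentSpace 𝓘(ℝ, E) ((extChartAt 𝓘(ℝ, E) x₀).symm y))}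
    (hη : NondegenerateOn (η ((extChartAt 𝓘(ℝ, E) x₀).symm y)) W) {W' : Submodule ℝ E}
    (hW : ∀ v, v ∈ W' ↔ chartSymmDeriv x₀ y v ∈ W) :
    NondegenerateOn (formInChart η x₀ y) W' := by
  intro u hu h
  have h0 : chartSymmDeriv x₀ y u = 0 := by
    refine hη _ ((hW u).1 hu) fun w hw => ?_
    obtain ⟨w', rfl⟩ := surjective_chartSymmDeriv hy w
    rw [← formInChart_two_apply]
    exact h _ ((hW _).2 hw)
  rw [← mfderiv_chartSymmDeriv hy u, h0]
  exact map_zero _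

/-- The expression of `π : M → B` in the preferred charts around `x₀` and `b₀`. -/
noncomputable def projInChart (EB : Type*) [NormedAddCommGroup EB] [NormedSpace ℝ EB]
    {B : Type*} [TopologicalSpace B] [ChartedSpace EB B] (π : M → B) (x₀ : M) (b₀ : B) : E → EB :=
  (extChartAt 𝓘(ℝ, EB) b₀ ∘ π) ∘ (extChartAt 𝓘(ℝ, E) x₀).symm

variable {π : M → B} {x₀ : M} {b₀ : B} {y : E}

theorem eventually_mem_chart (hπ : ContMDiff 𝓘(ℝ, E) 𝓘(ℝ, EB) ∞ π)
    (hy : y ∈ (extChartAt 𝓘(ℝ, E) x₀).target) :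
    ∀ᶠ z in 𝓝 y, z ∈ (extChartAt 𝓘(ℝ, E) x₀).target ∧
      π ((extChartAt 𝓘(ℝ, E) x₀).symm z) ∈
        (chartAt EB (π ((extChartAt 𝓘(ℝ, E) x₀).symm y))).source := by
  refine Filter.Eventually.and (extChartAt_target_mem_nhds' hy) ?_
  have hc : ContinuousAt (π ∘ (extChartAt 𝓘(ℝ, E) x₀).symm) y :=
    hπ.continuous.continuousAt.comp (mdifferentiableAt_extChartAt_symm hy).continuousAt
  exact hc ((chartAt EB _).open_source.mem_nhds (mem_chart_source EB _))

variable [IsManifold 𝓘(ℝ, EB) ∞ B]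

theorem contDiffAt_projInChart (hπ : ContMDiff 𝓘(ℝ, E) 𝓘(ℝ, EB) ∞ π)
    (hy : y ∈ (extChartAt 𝓘(ℝ, E) x₀).target)
    (hb : π ((extChartAt 𝓘(ℝ, E) x₀).symm y) ∈ (chartAt EB b₀).source) :
    ContDiffAt ℝ ∞ (projInChart EB π x₀ b₀) y :=
  contDiffAt_comp_extChartAt_symm le_rfl hy
    (ContMDiffAt.comp _ (contMDiffAt_extChartAt' hb) hπ.contMDiffAt)

theorem fderiv_projInChart (hπ : ContMDiff 𝓘(ℝ, E) 𝓘(ℝ, EB) ∞ π)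
    (hy : y ∈ (extChartAt 𝓘(ℝ, E) x₀).target)
    (hb : π ((extChartAt 𝓘(ℝ, E) x₀).symm y) ∈ (chartAt EB b₀).source) (v : E) :
    fderiv ℝ (projInChart EB π x₀ b₀) y v =
      mfderiv 𝓘(ℝ, EB) 𝓘(ℝ, EB) (extChartAt 𝓘(ℝ, EB) b₀) (π ((extChartAt 𝓘(ℝ, E) x₀).symm y))
        (mfderiv 𝓘(ℝ, E) 𝓘(ℝ, EB) π ((extChartAt 𝓘(ℝ, E) x₀).symm y) (chartSymmDeriv x₀ y v)) := by
  have h1 : MDifferentiableAt 𝓘(ℝ, EB) 𝓘(ℝ, EB) (extChartAt 𝓘(ℝ, EB) b₀)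
    (π ((extChartAt 𝓘(ℝ, E) x₀).symm y)) := mdifferentiableAt_extChartAt hb
  have h2 : MDifferentiableAt 𝓘(ℝ, E) 𝓘(ℝ, EB) π ((extChartAt 𝓘(ℝ, E) x₀).symm y) :=
    hπ.mdifferentiableAt (by simp)
  rw [projInChart, fderiv_comp_extChartAt_symm hy (h1.comp _ h2), mfderiv_comp _ h1 h2]
  rfl

theorem mfderiv_extChartAt_bijective {b : B} (hb : b ∈ (chartAt EB b₀).source) :
    Function.Bijective (mfderiv 𝓘(ℝ, EB) 𝓘(ℝ, EB) (extChartAt 𝓘(ℝ, EB) b₀) b) := by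
  obtain ⟨Φ, hΦ⟩ := isInvertible_mfderiv_extChartAt (I := 𝓘(ℝ, EB)) (x := b₀) (y := b)
    (by rwa [extChartAt_source])
  rw [← hΦ]
  exact Φ.bijective

theorem fderiv_projInChart_eq_zero_iff (hπ : ContMDiff 𝓘(ℝ, E) 𝓘(ℝ, EB) ∞ π)
    (hy : y ∈ (extChartAt 𝓘(ℝ, E) x₀).target)
    (hb : π ((extChartAt 𝓘(ℝ, E) x₀).symm y) ∈ (chartAt EB b₀).source) (v : E) :
    fderiv ℝ (projInChart EB π x₀ b₀) y v = 0 ↔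
      chartSymmDeriv x₀ y v ∈ verticalSpace EB E π ((extChartAt 𝓘(ℝ, E) x₀).symm y) := by
  rw [fderiv_projInChart hπ hy hb]
  exact map_eq_zero_iff _ (mfderiv_extChartAt_bijective hb).1

theorem surjective_fderiv_projInChart (hπ : ContMDiff 𝓘(ℝ, E) 𝓘(ℝ, EB) ∞ π)
    (hπs : ∀ x, Function.Surjective (mfderiv 𝓘(ℝ, E) 𝓘(ℝ, EB) π x))
    (hy : y ∈ (extChartAt 𝓘(ℝ, E) x₀).target)
    (hb : π ((extChartAt 𝓘(ℝ, E) x₀).symm y) ∈ (chartAt EB b₀).source) :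
    Function.Surjective (fderiv ℝ (projInChart EB π x₀ b₀) y) := by
  intro c
  obtain ⟨c', rfl⟩ := (mfderiv_extChartAt_bijective (EB := EB) hb).2 c
  obtain ⟨v, rfl⟩ := hπs _ c'
  obtain ⟨u, rfl⟩ := surjective_chartSymmDeriv hy v
  exact ⟨u, fderiv_projInChart hπ hy hb u⟩

end Vertical

/-! ### Jacobi brackets from Hamiltonian vector fields -/

section Hamiltonian

open Topology VectorField

variable {EB : Type*} [NormedAddCommGroup EB] [NormedSpace ℝ EB]
  {B : Type*} [TopologicalSpace B] [ChartedSpace EB B] [IsManifold 𝓘(ℝ, EB) ∞ B]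
  {E : Type*} [NormedAddCommGroup E] [NormedSpace ℝ E]
  {M : Type*} [TopologicalSpace M] [ChartedSpace E M]

/-- A vector field is smooth if its expression in every preferred chart is. -/
def IsSmoothField (V : ∀ x : M, TangentSpace 𝓘(ℝ, E) x) : Prop :=
  ∀ (x₀ : M) (y : E), y ∈ (extChartAt 𝓘(ℝ, E) x₀).target → ContDiffAt ℝ ∞ (fieldInChart V x₀) y

variable [IsManifold 𝓘(ℝ, E) ∞ M]

/-- The derivative of a function along a vector field, computed in a chart. -/
theorem fderiv_apply_fieldInChart {f : M → ℝ} {x₀ : M} {y : E}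
    (hy : y ∈ (extChartAt 𝓘(ℝ, E) x₀).target)
    (hf : MDifferentiableAt 𝓘(ℝ, E) 𝓘(ℝ, ℝ) f ((extChartAt 𝓘(ℝ, E) x₀).symm y))
    (Z : ∀ x : M, TangentSpace 𝓘(ℝ, E) x) :
    fderiv ℝ (f ∘ (extChartAt 𝓘(ℝ, E) x₀).symm) y (fieldInChart Z x₀ y) =
      differential f ((extChartAt 𝓘(ℝ, E) x₀).symm y) (Z ((extChartAt 𝓘(ℝ, E) x₀).symm y)) := by
  rw [fderiv_comp_extChartAt_symm hy hf, chartSymmDeriv_fieldInChart Z hy]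
  rfl

/-- `(f, g) ↦ V_f g - g R f` is a Jacobi bracket if it is antisymmetric and the fields `V_f` are
vertical and Hamiltonian for a closed `2`-form `η` in the generalised sense that
`η(V_f, ·) = -df + (R f) θ` on vertical vectors, where either `R` vanishes or `θ(V_f) = f` and
`θ([V_f, V_g])` is the bracket of `f` and `g`. -/
theorem isJacobiBracket_of_hamiltonian {π : M → B} (hπ : ContMDiff 𝓘(ℝ, E) 𝓘(ℝ, EB) ∞ π)
    {η : DiffForm E M 2} (hη : η.IsClosed)
    {θ : ∀ x : M, TangentSpace 𝓘(ℝ, E) x [⋀^Fin 1]→L[ℝ] ℝ}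
    {V : (M → ℝ) → ∀ x : M, TangentSpace 𝓘(ℝ, E) x} {R : ∀ x : M, TangentSpace 𝓘(ℝ, E) x}
    {br : (M → ℝ) → (M → ℝ) → M → ℝ}
    (hbr : ∀ f g : M → ℝ, ContMDiff 𝓘(ℝ, E) 𝓘(ℝ, ℝ) ∞ f → ContMDiff 𝓘(ℝ, E) 𝓘(ℝ, ℝ) ∞ g →
      ∀ x, br f g x = differential g x (V f x) - g x * differential f x (R x))
    (hanti : ∀ f g : M → ℝ, br f g = - br g f)
    (hV : ∀ f : M → ℝ, ContMDiff 𝓘(ℝ, E) 𝓘(ℝ, ℝ) ∞ f → IsSmoothField (V f))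
    (hR : IsSmoothField R)
    (hvert : ∀ f : M → ℝ, ContMDiff 𝓘(ℝ, E) 𝓘(ℝ, ℝ) ∞ f → ∀ x, V f x ∈ verticalSpace EB E π x)
    (hham : ∀ f : M → ℝ, ContMDiff 𝓘(ℝ, E) 𝓘(ℝ, ℝ) ∞ f → ∀ x, ∀ w ∈ verticalSpace EB E π x,
      η x ![V f x, w] = - differential f x w + differential f x (R x) * θ x ![w])
    (hθ : (∀ x, R x = 0) ∨ ∀ f g : M → ℝ, ContMDiff 𝓘(ℝ, E) 𝓘(ℝ, ℝ) ∞ f →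
      ContMDiff 𝓘(ℝ, E) 𝓘(ℝ, ℝ) ∞ g → (∀ x, θ x ![V f x] = f x) ∧
      ∀ (x₀ : M) (y : E), y ∈ (extChartAt 𝓘(ℝ, E) x₀).target →
        formInChart θ x₀ y ![lieBracket ℝ (fieldInChart (V f) x₀) (fieldInChart (V g) x₀) y] =
          br f g ((extChartAt 𝓘(ℝ, E) x₀).symm y)) :
    IsJacobiBracket E br := by
  have hmd {f : M → ℝ} (hf : ContMDiff 𝓘(ℝ, E) 𝓘(ℝ, ℝ) ∞ f) (x : M) :
      MDifferentiableAt 𝓘(ℝ, E) 𝓘(ℝ, ℝ) f x := hf.mdifferentiableAt (by simp)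
  have hder {f : M → ℝ} (hf : ContMDiff 𝓘(ℝ, E) 𝓘(ℝ, ℝ) ∞ f) (Z : ∀ x : M, TangentSpace 𝓘(ℝ, E) x)
      {x₀ : M} {y : E} (hy : y ∈ (extChartAt 𝓘(ℝ, E) x₀).target) :=
    fderiv_apply_fieldInChart hy (hmd hf _) Z
  have hloc {f : M → ℝ} (hf : ContMDiff 𝓘(ℝ, E) 𝓘(ℝ, ℝ) ∞ f) {x₀ : M} {y : E}
      (hy : y ∈ (extChartAt 𝓘(ℝ, E) x₀).target) :
      ContDiffAt ℝ ∞ (f ∘ (extChartAt 𝓘(ℝ, E) x₀).symm) y :=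
    contDiffAt_comp_extChartAt_symm le_rfl hy hf.contMDiffAt
  have hsmooth (f g : M → ℝ) (hf : ContMDiff 𝓘(ℝ, E) 𝓘(ℝ, ℝ) ∞ f)
      (hg : ContMDiff 𝓘(ℝ, E) 𝓘(ℝ, ℝ) ∞ g) : ContMDiff 𝓘(ℝ, E) 𝓘(ℝ, ℝ) ∞ (br f g) := by
    intro x₀
    have hy := mem_extChartAt_target (I := 𝓘(ℝ, E)) x₀
    refine contMDiffAt_of_contDiffAt_chart le_rfl ?_
    have hf' := hloc hf hy
    have hg' := hloc hg hy
    have h := (((hg'.fderiv_right (m := ∞) (by simp)).clm_apply (hV f hf x₀ _ hy))).sub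
      (hg'.mul ((hf'.fderiv_right (m := ∞) (by simp)).clm_apply (hR x₀ _ hy)))
    refine h.congr_of_eventuallyEq ?_
    filter_upwards [extChartAt_target_mem_nhds (I := 𝓘(ℝ, E)) x₀] with y hy
    rw [hder hg _ hy, hder hf _ hy]
    exact hbr f g hf hg _
  -- the Hamiltonian condition for a pair of fields, in terms of the bracket
  have hpair (f g : M → ℝ) (hf : ContMDiff 𝓘(ℝ, E) 𝓘(ℝ, ℝ) ∞ f)
      (hg : ContMDiff 𝓘(ℝ, E) 𝓘(ℝ, ℝ) ∞ g) (x : M) :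
      η x ![V f x, V g x] =
        differential g x (V f x) - differential f x (V g x) - br f g x := by
    rw [hham f hf x _ (hvert g hg x), hbr f g hf hg]
    rcases hθ with h0 | h1
    · rw [h0 x, map_zero]; ring
    · rw [(h1 g g hg hg).1 x]; ring
  have hpair' (f g : M → ℝ) (hf : ContMDiff 𝓘(ℝ, E) 𝓘(ℝ, ℝ) ∞ f)
      (hg : ContMDiff 𝓘(ℝ, E) 𝓘(ℝ, ℝ) ∞ g) {x₀ : M} {y : E}
      (hy : y ∈ (extChartAt 𝓘(ℝ, E) x₀).target) :
      ∀ᶠ z in 𝓝 y, formInChart η.toFun x₀ z ![fieldInChart (V f) x₀ z, fieldInChart (V g) x₀ z] =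
        fderiv ℝ (g ∘ (extChartAt 𝓘(ℝ, E) x₀).symm) z (fieldInChart (V f) x₀ z) -
        fderiv ℝ (f ∘ (extChartAt 𝓘(ℝ, E) x₀).symm) z (fieldInChart (V g) x₀ z) -
        (br f g ∘ (extChartAt 𝓘(ℝ, E) x₀).symm) z := by
    filter_upwards [extChartAt_target_mem_nhds' hy] with z hz
    rw [formInChart_two_apply, chartSymmDeriv_fieldInChart _ hz, chartSymmDeriv_fieldInChart _ hz,
      hder hg _ hz, hder hf _ hz]
    exact hpair f g hf hg _
  -- the Hamiltonian condition for the Lie bracket of two fields, which is again vertical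
  have hlie (f g h : M → ℝ) (hf : ContMDiff 𝓘(ℝ, E) 𝓘(ℝ, ℝ) ∞ f)
      (hg : ContMDiff 𝓘(ℝ, E) 𝓘(ℝ, ℝ) ∞ g) (hh : ContMDiff 𝓘(ℝ, E) 𝓘(ℝ, ℝ) ∞ h) {x₀ : M} {y : E}
      (hy : y ∈ (extChartAt 𝓘(ℝ, E) x₀).target) :
      formInChart η.toFun x₀ y ![fieldInChart (V h) x₀ y,
        lieBracket ℝ (fieldInChart (V f) x₀) (fieldInChart (V g) x₀) y] =
        - fderiv ℝ (h ∘ (extChartAt 𝓘(ℝ, E) x₀).symm) y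
          (lieBracket ℝ (fieldInChart (V f) x₀) (fieldInChart (V g) x₀) y) +
        differential h ((extChartAt 𝓘(ℝ, E) x₀).symm y) (R ((extChartAt 𝓘(ℝ, E) x₀).symm y)) *
          (br f g ∘ (extChartAt 𝓘(ℝ, E) x₀).symm) y := by
    have hev := eventually_mem_chart hπ hy
    have hP := contDiffAt_projInChart hπ hy hev.self_of_nhds.2
    have hz (k : M → ℝ) (hk : ContMDiff 𝓘(ℝ, E) 𝓘(ℝ, ℝ) ∞ k) :
        (fun z => fderiv ℝ (projInChart EB π x₀ (π ((extChartAt 𝓘(ℝ, E) x₀).symm y))) z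
          (fieldInChart (V k) x₀ z)) =ᶠ[𝓝 y] fun _ => 0 := by
      filter_upwards [hev] with z hz
      rw [fderiv_projInChart_eq_zero_iff hπ hz.1 hz.2, chartSymmDeriv_fieldInChart _ hz.1]
      exact hvert k hk _
    have hver : fderiv ℝ (projInChart EB π x₀ (π ((extChartAt 𝓘(ℝ, E) x₀).symm y))) y
        (lieBracket ℝ (fieldInChart (V f) x₀) (fieldInChart (V g) x₀) y) = 0 := by
      rw [fderiv_apply_lieBracket hP two_le_infty
        ((hV g hg x₀ y hy).differentiableAt (by simp)) ((hV f hf x₀ y hy).differentiableAt (by simp)),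
        (hz f hf).fderiv_eq, (hz g hg).fderiv_eq]
      simp
    rw [fderiv_projInChart_eq_zero_iff hπ hy hev.self_of_nhds.2] at hver
    rw [formInChart_two_apply, chartSymmDeriv_fieldInChart _ hy, hham h hh _ _ hver,
      fderiv_comp_extChartAt_symm hy (hmd hh _), ← formInChart_one_apply]
    congr 1
    rcases hθ with h0 | h1
    · rw [h0, map_zero, zero_mul, zero_mul]
    · rw [(h1 f g hf hg).2 x₀ y hy]; rfl
  refine ⟨hsmooth, ?_, ?_, fun f g _ _ => hanti f g, ?_, ?_⟩
  · intro f g h hf hg hh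
    funext x
    have hd : differential (g + h) x = differential g x + differential h x :=
      ((hmd hg x).hasMFDerivAt.add (hmd hh x).hasMFDerivAt).mfderiv
    rw [hbr f (g + h) hf (hg.add hh), Pi.add_apply, Pi.add_apply, hbr f g hf hg, hbr f h hf hh, hd]
    change (differential g x (V f x) + differential h x (V f x)) - (g x + h x) * _ = _
    ring
  · intro c f g hf hg
    funext x
    have hcg : ContMDiff 𝓘(ℝ, E) 𝓘(ℝ, ℝ) ∞ (c • g) :=
      (contMDiff_const (c := c)).mul hg
    have hd : differential (c • g) x = c • differential g x :=
      ((hmd hg x).hasMFDerivAt.const_smul c).mfderiv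
    rw [hbr f (c • g) hf hcg, Pi.smul_apply, Pi.smul_apply, hbr f g hf hg, hd]
    change c • differential g x (V f x) - (c * g x) * _ = c * (_ - _)
    simp only [smul_eq_mul]
    ring
  · intro f g h hf hg hh
    funext x₀
    -- stated at the image of a chart point, which is only propositionally equal to `x₀`
    have key (y : E) (hy : y ∈ (extChartAt 𝓘(ℝ, E) x₀).target) :
        (br f (br g h) + br g (br h f) + br h (br f g)) ((extChartAt 𝓘(ℝ, E) x₀).symm y) = 0 := by
      have hCD {k : M → ℝ} (hk : ContMDiff 𝓘(ℝ, E) 𝓘(ℝ, ℝ) ∞ k) :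
          ContDiffAt ℝ 2 (k ∘ (extChartAt 𝓘(ℝ, E) x₀).symm) y :=
        (hloc hk hy).of_le (by simpa using two_le_infty)
      have hD {k : M → ℝ} (hk : ContMDiff 𝓘(ℝ, E) 𝓘(ℝ, ℝ) ∞ k) :
          DifferentiableAt ℝ (k ∘ (extChartAt 𝓘(ℝ, E) x₀).symm) y :=
        (hloc hk hy).differentiableAt (by simp)
      have hVD {k : M → ℝ} (hk : ContMDiff 𝓘(ℝ, E) 𝓘(ℝ, ℝ) ∞ k) :
          DifferentiableAt ℝ (fieldInChart (V k) x₀) y :=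
        (hV k hk x₀ y hy).differentiableAt (by simp)
      have hJ := jacobi_of_hamiltonian
        (((η.smooth' x₀).contDiffAt (extChartAt_target_mem_nhds' hy)).differentiableAt (by simp))
        (DiffForm.extDeriv_formInChart_eq_zero hη hy) (hVD hf) (hVD hg) (hVD hh)
        (hCD hf) (hCD hg) (hCD hh) (hD (hsmooth f g hf hg)) (hD (hsmooth g h hg hh))
        (hD (hsmooth h f hh hf)) (hpair' f g hf hg hy) (hpair' g h hg hh hy) (hpair' h f hh hf hy)
        (hlie f g h hf hg hh hy) (hlie g h f hg hh hf hy) (hlie h f g hh hf hg hy)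
      rw [hder (hsmooth g h hg hh) _ hy, hder (hsmooth h f hh hf) _ hy,
        hder (hsmooth f g hf hg) _ hy] at hJ
      change br f (br g h) _ + br g (br h f) _ + br h (br f g) _ = 0
      rw [hbr f _ hf (hsmooth g h hg hh), hbr g _ hg (hsmooth h f hh hf),
        hbr h _ hh (hsmooth f g hf hg)]
      exact hJ
    have := key _ (mem_extChartAt_target (I := 𝓘(ℝ, E)) x₀)
    rwa [extChartAt_to_inv] at this
  · intro f g h hf hg hh
    funext x
    have hd : differential (g * h) x = g x • differential h x + h x • differential g x :=
      ((hmd hg x).hasMFDerivAt.mul (hmd hh x).hasMFDerivAt).mfderiv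
    have hd1 : differential (1 : M → ℝ) x = 0 :=
      mfderiv_const (I := 𝓘(ℝ, E)) (I' := 𝓘(ℝ, ℝ)) (c := (1 : ℝ))
    have h1 : ContMDiff 𝓘(ℝ, E) 𝓘(ℝ, ℝ) ∞ (1 : M → ℝ) := contMDiff_const
    change br f (g * h) x = g x * br f h x + h x * br f g x - g x * h x * br f 1 x
    rw [hbr f (g * h) hf (hg.mul hh), Pi.mul_apply, hbr f g hf hg, hbr f h hf hh, hbr f 1 hf h1,
      hd, hd1]
    change (g x • differential h x (V f x) + h x • differential g x (V f x)) - (g x * h x) * _ =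
      _ - _ * (0 - (1 : ℝ) * _)
    simp only [smul_eq_mul]
    ring

end Hamiltonian

section Brackets

open Topology VectorField

variable {EB : Type*} [NormedAddCommGroup EB] [NormedSpace ℝ EB]
  {B : Type*} [TopologicalSpace B] [ChartedSpace EB B]
  {E : Type*} [NormedAddCommGroup E] [NormedSpace ℝ E]
  {M : Type*} [TopologicalSpace M] [ChartedSpace E M]

instance finiteDimensional_tangentSpace [FiniteDimensional ℝ E] (x : M) :
    FiniteDimensional ℝ (TangentSpace 𝓘(ℝ, E) x) :=
  inferInstanceAs (FiniteDimensional ℝ E)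

theorem tensorBracket_inverseBivector_swap
    (η : ∀ x : M, TangentSpace 𝓘(ℝ, E) x [⋀^Fin 2]→L[ℝ] ℝ)
    (W : ∀ x : M, Submodule ℝ (TangentSpace 𝓘(ℝ, E) x)) (R : ∀ x : M, TangentSpace 𝓘(ℝ, E) x)
    (f g : M → ℝ) :
    tensorBracket (fun x => inverseBivector (η x) (W x)) R f g =
      - tensorBracket (fun x => inverseBivector (η x) (W x)) R g f := by
  funext x
  simp only [tensorBracket, Pi.neg_apply]
  rw [inverseBivector_swap]
  ring

/-! ### The fibrewise contact bracket -/

/-- The projection of a vertical vector to the contact hyperplane along a vertical vector on which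
`Θ` equals `1`. -/
theorem sub_smul_mem_verticalContactSpace {π : M → B} {Θ : DiffForm E M 1} {x : M}
    {v r : TangentSpace 𝓘(ℝ, E) x} (hv : v ∈ verticalSpace EB E π x)
    (hr : r ∈ verticalSpace EB E π x) (hr1 : Θ x ![r] = 1) :
    v - Θ x ![v] • r ∈ verticalContactSpace EB π Θ x := by
  refine ⟨Submodule.sub_mem _ hv (Submodule.smul_mem _ _ hr), ?_⟩
  rw [← oneFormLinear_apply, map_sub, map_smul, oneFormLinear_apply, oneFormLinear_apply, hr1]
  simp

variable [FiniteDimensional ℝ E]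

theorem verticalReeb_spec {π : M → B} {Θ : DiffForm E M 1} (hΘ : IsFibrewiseContactForm EB π Θ)
    (x : M) : verticalReeb EB π Θ x ∈ verticalSpace EB E π x ∧ Θ x ![verticalReeb EB π Θ x] = 1 ∧
      ∀ w ∈ verticalSpace EB E π x, Θ.d x ![verticalReeb EB π Θ x, w] = 0 := by
  have hex : ∃ v ∈ verticalSpace EB E π x, Θ x ![v] = 1 ∧
      ∀ w ∈ verticalSpace EB E π x, Θ.d x ![v, w] = 0 := by
    obtain ⟨⟨v, hv, hv0⟩, hnd⟩ := hΘ x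
    obtain ⟨v₁, hv₁, h1⟩ : ∃ v ∈ verticalSpace EB E π x, Θ x ![v] = 1 := by
      refine ⟨(Θ x ![v])⁻¹ • v, Submodule.smul_mem _ _ hv, ?_⟩
      rw [← oneFormLinear_apply, map_smul, oneFormLinear_apply, smul_eq_mul, inv_mul_cancel₀ hv0]
    -- correct `v₁` by a vector of the contact hyperplane
    obtain ⟨u, ⟨hu, hu0⟩, h⟩ := hnd.exists_eq (- twoFormBilin (Θ.d x) v₁)
    have hr : u + v₁ ∈ verticalSpace EB E π x := Submodule.add_mem _ hu hv₁
    have hr1 : Θ x ![u + v₁] = 1 := by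
      rw [← oneFormLinear_apply, map_add, oneFormLinear_apply, oneFormLinear_apply, hu0, h1, zero_add]
    have hrH (w) (hw : w ∈ verticalContactSpace EB π Θ x) : Θ.d x ![u + v₁, w] = 0 := by
      rw [← twoFormBilin_apply, LinearMap.map_add₂, twoFormBilin_apply, h w hw]
      simp
    -- it remains to test against vectors that are not horizontal
    refine ⟨u + v₁, hr, hr1, fun w hw => ?_⟩
    have := hrH _ (sub_smul_mem_verticalContactSpace hw hr hr1)
    rwa [← twoFormBilin_apply, map_sub, map_smul, twoFormBilin_apply, twoFormBilin_apply,
      twoForm_self, smul_zero, sub_zero] at this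
  rw [verticalReeb, dif_pos hex]
  exact hex.choose_spec

/-- The vertical contact vector field with Hamiltonian `f`: the vertical field `V` with `Θ(V) = f` and
`dΘ(V, ·) = -df + (R f) Θ` on vertical vectors. -/
noncomputable def contactField (EB : Type*) [NormedAddCommGroup EB] [NormedSpace ℝ EB]
    {B : Type*} [TopologicalSpace B] [ChartedSpace EB B]
    (π : M → B) (Θ : DiffForm E M 1) (f : M → ℝ) (x : M) :
    TangentSpace 𝓘(ℝ, E) x :=
  f x • verticalReeb EB π Θ x
    - sharp (Θ.d x) (verticalContactSpace EB π Θ x) (differential f x)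

section Contact

variable {π : M → B} {Θ : DiffForm E M 1}

theorem contactField_mem (hΘ : IsFibrewiseContactForm EB π Θ) (f : M → ℝ) (x : M) :
    contactField EB π Θ f x ∈ verticalSpace EB E π x :=
  Submodule.sub_mem _ (Submodule.smul_mem _ _ (verticalReeb_spec hΘ x).1)
    (sharp_mem (hΘ x).2 (differential f x)).1

theorem apply_contactField (hΘ : IsFibrewiseContactForm EB π Θ) (f : M → ℝ) (x : M) :
    Θ x ![contactField EB π Θ f x] = f x := by
  rw [← oneFormLinear_apply, contactField, map_sub, map_smul, oneFormLinear_apply,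
    oneFormLinear_apply, (verticalReeb_spec hΘ x).2.1, (sharp_mem (hΘ x).2 (differential f x)).2]
  simp

theorem d_contactField (hΘ : IsFibrewiseContactForm EB π Θ) (f : M → ℝ) (x : M)
    {w : TangentSpace 𝓘(ℝ, E) x} (hw : w ∈ verticalSpace EB E π x) :
    Θ.d x ![contactField EB π Θ f x, w] =
      - differential f x w + differential f x (verticalReeb EB π Θ x) * Θ x ![w] := by
  obtain ⟨hR, hR1, hR0⟩ := verticalReeb_spec hΘ x
  have hs := sharp_mem (hΘ x).2 (differential f x)
  have h := apply_sharp (hΘ x).2 (differential f x) (sub_smul_mem_verticalContactSpace hw hR hR1)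
  rw [← twoFormBilin_apply, map_sub, map_smul, twoFormBilin_apply, twoFormBilin_apply,
    twoForm_swap _ _ (verticalReeb EB π Θ x), hR0 _ hs.1, map_sub, map_smul] at h
  rw [← twoFormBilin_apply, contactField, LinearMap.map_sub₂, LinearMap.map_smul₂,
    twoFormBilin_apply, twoFormBilin_apply, hR0 w hw]
  simp only [smul_eq_mul] at h ⊢
  linarith

theorem fibrewiseContactBracket_apply (hΘ : IsFibrewiseContactForm EB π Θ) (f g : M → ℝ) (x : M) :
    fibrewiseContactBracket EB π Θ f g x = differential g x (contactField EB π Θ f x)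
      - g x * differential f x (verticalReeb EB π Θ x) := by
  rw [fibrewiseContactBracket, tensorBracket, inverseBivector_eq (hΘ x).2, contactField, map_sub,
    map_smul, smul_eq_mul]
  ring

variable [FiniteDimensional ℝ EB] [IsManifold 𝓘(ℝ, EB) ∞ B] [IsManifold 𝓘(ℝ, E) ∞ M]

/-- The contact field of `f` solves `dπ(V) = 0`, `Θ(V) = f` and `dΘ(V, ·) = -df` on the vertical contact
hyperplane, a nondegenerate linear system with smooth coefficients. -/
theorem isSmoothField_contactField (hΘ : IsFibrewiseContactForm EB π Θ)
    {f : M → ℝ} (hπ : ContMDiff 𝓘(ℝ, E) 𝓘(ℝ, EB) ∞ π)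
    (hπs : ∀ x, Function.Surjective (mfderiv 𝓘(ℝ, E) 𝓘(ℝ, EB) π x))
    (hf : ContMDiff 𝓘(ℝ, E) 𝓘(ℝ, ℝ) ∞ f) : IsSmoothField (contactField EB π Θ f) := by
  intro x₀ y₀ hy₀
  have hev := eventually_mem_chart hπ hy₀
  have hP := contDiffAt_projInChart hπ hy₀ hev.self_of_nhds.2
  have hf' := contDiffAt_comp_extChartAt_symm le_rfl hy₀ hf.contMDiffAt
  have hΘ' : ContDiffAt ℝ ∞ (fun y => oneFormCLM E (formInChart Θ.toFun x₀ y)) y₀ := by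
    have := (Θ.smooth' x₀).contDiffAt (extChartAt_target_mem_nhds' hy₀)
    fun_prop
  have hmem {y : E} (hy : y ∈ (extChartAt 𝓘(ℝ, E) x₀).target ∧
      π ((extChartAt 𝓘(ℝ, E) x₀).symm y) ∈
        (chartAt EB (π ((extChartAt 𝓘(ℝ, E) x₀).symm y₀))).source) (v : E) :
      (fderiv ℝ (projInChart EB π x₀ (π ((extChartAt 𝓘(ℝ, E) x₀).symm y₀))) y).prod
          (oneFormCLM E (formInChart Θ.toFun x₀ y)) v = 0 ↔
        chartSymmDeriv x₀ y v ∈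
          verticalContactSpace EB π Θ ((extChartAt 𝓘(ℝ, E) x₀).symm y) := by
    rw [ContinuousLinearMap.prod_apply, Prod.mk_eq_zero,
      fderiv_projInChart_eq_zero_iff hπ hy.1 hy.2, oneFormCLM_apply, formInChart_one_apply]
    rfl
  refine contDiffAt_of_lagrangeSystem
    (A := fun y => (fderiv ℝ (projInChart EB π x₀ (π ((extChartAt 𝓘(ℝ, E) x₀).symm y₀))) y).prod
      (oneFormCLM E (formInChart Θ.toFun x₀ y)))
    (c := fun y => (0, (f ∘ (extChartAt 𝓘(ℝ, E) x₀).symm) y))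
    (α := fun y => - fderiv ℝ (f ∘ (extChartAt 𝓘(ℝ, E) x₀).symm) y)
    ((Θ.extDiff.smooth' x₀).contDiffAt (extChartAt_target_mem_nhds' hy₀))
    ?_ (hf'.fderiv_right (m := ∞) (by simp)).neg (contDiffAt_const.prodMk hf')
    ?_ ?_ ?_
  · have := hP.fderiv_right (m := ∞) (by simp)
    exact (ContinuousLinearMap.prodₗᵢ ℝ).contDiff.contDiffAt.comp y₀ (this.prodMk hΘ')
  · filter_upwards [hev] with y hy
    rintro ⟨c, t⟩
    obtain ⟨u, rfl⟩ := surjective_fderiv_projInChart hπ hπs hy.1 hy.2 c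
    obtain ⟨hR, hR1, hR0⟩ := verticalReeb_spec hΘ ((extChartAt 𝓘(ℝ, E) x₀).symm y)
    obtain ⟨r, hr⟩ := surjective_chartSymmDeriv hy.1
      (verticalReeb EB π Θ ((extChartAt 𝓘(ℝ, E) x₀).symm y))
    rw [← hr] at hR hR1
    rw [← fderiv_projInChart_eq_zero_iff hπ hy.1 hy.2] at hR
    rw [← formInChart_one_apply, ← oneFormCLM_apply] at hR1
    refine ⟨u + (t - oneFormCLM E (formInChart Θ.toFun x₀ y) u) • r, ?_⟩
    rw [ContinuousLinearMap.prod_apply, map_add, map_add, map_smul, map_smul, hR, hR1]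
    simp
  · filter_upwards [hev] with y hy
    exact (hΘ _).2.formInChart (η := Θ.d) hy.1 (hmem hy)
  · filter_upwards [hev] with y hy
    refine ⟨?_, fun w hw => ?_⟩
    · refine Prod.ext ?_ ?_
      · change fderiv ℝ _ y _ = 0
        rw [fderiv_projInChart_eq_zero_iff hπ hy.1 hy.2, chartSymmDeriv_fieldInChart _ hy.1]
        exact contactField_mem hΘ f _
      · change oneFormCLM E _ _ = _
        rw [oneFormCLM_apply, formInChart_one_apply, chartSymmDeriv_fieldInChart _ hy.1]
        exact apply_contactField hΘ f _
    · rw [hmem hy] at hw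
      rw [formInChart_two_apply, chartSymmDeriv_fieldInChart _ hy.1,
        neg_apply,
        fderiv_comp_extChartAt_symm hy.1 (hf.mdifferentiableAt (by simp))]
      refine (d_contactField hΘ f _ hw.1).trans ?_
      rw [hw.2, mul_zero, add_zero]
      rfl

/-- The fibrewise contact bracket of a `1`-form that restricts to contact forms on the fibres of a
submersion is a Jacobi bracket. -/
theorem isJacobiBracket_fibrewiseContactBracket (hΘ : IsFibrewiseContactForm EB π Θ)
    (hπ : ContMDiff 𝓘(ℝ, E) 𝓘(ℝ, EB) ∞ π)
    (hπs : ∀ x, Function.Surjective (mfderiv 𝓘(ℝ, E) 𝓘(ℝ, EB) π x)) :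
    IsJacobiBracket E (fibrewiseContactBracket EB π Θ) := by
  have hV (f : M → ℝ) (hf : ContMDiff 𝓘(ℝ, E) 𝓘(ℝ, ℝ) ∞ f) :=
    isSmoothField_contactField hΘ hπ hπs hf
  have hR : IsSmoothField (verticalReeb EB π Θ) := by
    -- the Reeb field is the contact field of the constant function `1`
    have h1 := hV (fun _ => 1) contMDiff_const
    convert h1 using 1
    funext x
    have hd : differential (fun _ : M => (1 : ℝ)) x = 0 :=
      mfderiv_const (I := 𝓘(ℝ, E)) (I' := 𝓘(ℝ, ℝ)) (c := (1 : ℝ))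
    rw [contactField, hd, sharp_eq (hΘ x).2 (u := 0) (Submodule.zero_mem _), one_smul, sub_zero]
    intro w _
    rw [← twoFormBilin_apply, LinearMap.map_zero₂]
    rfl
  refine isJacobiBracket_of_hamiltonian (θ := Θ.toFun) hπ Θ.isClosed_extDiff
    (fun f g _ _ x => fibrewiseContactBracket_apply hΘ f g x)
    (tensorBracket_inverseBivector_swap _ _ _) hV hR
    (fun f _ x => contactField_mem hΘ f x) (fun f _ x w hw => d_contactField hΘ f x hw)
    (Or.inr fun f g hf hg => ⟨apply_contactField hΘ f, fun x₀ y hy => ?_⟩)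
  -- evaluating `dΘ` on two contact fields computes `Θ` on their Lie bracket
  have h := extDeriv_oneForm_apply_vectorField
    (((Θ.smooth' x₀).contDiffAt (extChartAt_target_mem_nhds' hy)).differentiableAt (by simp))
    ((hV f hf x₀ y hy).differentiableAt (by simp)) ((hV g hg x₀ y hy).differentiableAt (by simp))
  have hev (k : M → ℝ) : (fun z => formInChart Θ.toFun x₀ z
      ![fieldInChart (contactField EB π Θ k) x₀ z]) =ᶠ[𝓝 y]
        k ∘ (extChartAt 𝓘(ℝ, E) x₀).symm := by
    filter_upwards [extChartAt_target_mem_nhds' hy] with z hz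
    rw [formInChart_one_apply, chartSymmDeriv_fieldInChart _ hz]
    exact apply_contactField hΘ k _
  rw [← formInChart_d Θ hy, formInChart_two_apply, chartSymmDeriv_fieldInChart _ hy,
    chartSymmDeriv_fieldInChart _ hy, d_contactField hΘ f _ (contactField_mem hΘ g _),
    apply_contactField hΘ, (hev f).fderiv_eq, (hev g).fderiv_eq,
    fderiv_apply_fieldInChart hy (hf.mdifferentiableAt (by simp)),
    fderiv_apply_fieldInChart hy (hg.mdifferentiableAt (by simp))] at h
  rw [fibrewiseContactBracket_apply hΘ]
  linarith

end Contact

variable [FiniteDimensional ℝ EB] [IsManifold 𝓘(ℝ, EB) ∞ B] [IsManifold 𝓘(ℝ, E) ∞ M]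

/-! ### The fibrewise Poisson bracket -/

/-- The fibrewise Poisson bracket of a closed `2`-form that is nondegenerate on the fibres of a
submersion is a Poisson bracket. -/
theorem isPoissonBracket_fibrewisePoissonBracket {p : M → B} (hp : ContMDiff 𝓘(ℝ, E) 𝓘(ℝ, EB) ∞ p)
    (hps : ∀ x, Function.Surjective (mfderiv 𝓘(ℝ, E) 𝓘(ℝ, EB) p x))
    {η : DiffForm E M 2} (hη : η.IsClosed)
    (hnd : ∀ x, NondegenerateOn (η x) (verticalSpace EB E p x)) :
    IsPoissonBracket E (fibrewisePoissonBracket EB p η) := by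
  have hbr (f g : M → ℝ) (x : M) : fibrewisePoissonBracket EB p η f g x =
      differential g x (- sharp (η x) (verticalSpace EB E p x) (differential f x)) := by
    rw [fibrewisePoissonBracket, tensorBracket, inverseBivector_eq (hnd x)]
    simp
  refine ⟨isJacobiBracket_of_hamiltonian (R := fun _ => 0) (θ := fun _ => 0) hp hη
    (V := fun f x => - sharp (η x) (verticalSpace EB E p x) (differential f x))
    (fun f g _ _ x => by rw [hbr f g x, map_zero, mul_zero, sub_zero])
    (tensorBracket_inverseBivector_swap _ _ _) ?_ ?_
    (fun f _ x => Submodule.neg_mem _ (sharp_mem (hnd x) _)) ?_ (Or.inl fun _ => rfl), ?_⟩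
  -- in a chart, `V_f` solves a nondegenerate linear system with smooth coefficients
  · intro f hf x₀ y₀ hy₀
    have hev := eventually_mem_chart hp hy₀
    have hP := contDiffAt_projInChart hp hy₀ hev.self_of_nhds.2
    have hf' := contDiffAt_comp_extChartAt_symm le_rfl hy₀ hf.contMDiffAt
    refine contDiffAt_of_lagrangeSystem (c := fun _ => 0)
      (α := fun y => - fderiv ℝ (f ∘ (extChartAt 𝓘(ℝ, E) x₀).symm) y)
      ((η.smooth' x₀).contDiffAt (extChartAt_target_mem_nhds' hy₀))
      (hP.fderiv_right (m := ∞) (by simp)) (hf'.fderiv_right (m := ∞) (by simp)).neg contDiffAt_const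
      ?_ ?_ ?_
    · filter_upwards [hev] with y hy
      exact surjective_fderiv_projInChart hp hps hy.1 hy.2
    · filter_upwards [hev] with y hy
      exact (hnd _).formInChart hy.1 fun v => fderiv_projInChart_eq_zero_iff hp hy.1 hy.2 v
    · filter_upwards [hev] with y hy
      refine ⟨?_, fun w hw => ?_⟩
      · rw [fderiv_projInChart_eq_zero_iff hp hy.1 hy.2, chartSymmDeriv_fieldInChart _ hy.1]
        exact Submodule.neg_mem _ (sharp_mem (hnd _) _)
      · rw [fderiv_projInChart_eq_zero_iff hp hy.1 hy.2] at hw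
        rw [formInChart_two_apply, chartSymmDeriv_fieldInChart _ hy.1,
          neg_apply,
          fderiv_comp_extChartAt_symm hy.1 (hf.mdifferentiableAt (by simp)),
          ← twoFormBilin_apply, LinearMap.map_neg₂, twoFormBilin_apply, apply_sharp (hnd _) _ hw]
        rfl
  · intro x₀ y hy
    have : fieldInChart (fun x : M => (0 : TangentSpace 𝓘(ℝ, E) x)) x₀ = fun _ => 0 :=
      funext fun z => map_zero _
    rw [this]
    exact contDiffAt_const
  · intro f hf x w hw
    rw [← twoFormBilin_apply, LinearMap.map_neg₂, twoFormBilin_apply, apply_sharp (hnd _) _ hw,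
      map_zero, zero_mul, add_zero]
  · intro f hf
    funext x
    have hd1 : differential (1 : M → ℝ) x = 0 :=
      mfderiv_const (I := 𝓘(ℝ, E)) (I' := 𝓘(ℝ, ℝ)) (c := (1 : ℝ))
    rw [hbr, hd1]
    rfl

end Brackets

/-! ### Projections of smooth bundles -/

section Bundles

variable {EB : Type*} [NormedAddCommGroup EB] [NormedSpace ℝ EB]
  {B : Type*} [TopologicalSpace B] [ChartedSpace EB B]
  {EF : Type*} [NormedAddCommGroup EF] [NormedSpace ℝ EF]
  {HF : Type*} [TopologicalSpace HF] {J : ModelWithCorners ℝ EF HF}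
  {F : Type*} [TopologicalSpace F] [ChartedSpace HF F]
  {E : Type*} [NormedAddCommGroup E] [NormedSpace ℝ E]
  {Z : Type*} [TopologicalSpace Z] [ChartedSpace E Z]
  {p : Z → B} {e : Bundle.Trivialization F p}

theorem contMDiffAt_proj_of_trivialization
    (he : ContMDiffOn 𝓘(ℝ, E) (𝓘(ℝ, EB).prod J) ∞ e e.source) {x : Z} (hx : x ∈ e.source) :
    ContMDiffAt 𝓘(ℝ, E) 𝓘(ℝ, EB) ∞ p x := by
  have h := (he.contMDiffAt (e.open_source.mem_nhds hx)).fst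
  refine h.congr_of_eventuallyEq ?_
  filter_upwards [e.open_source.mem_nhds hx] with z hz
  exact (e.coe_fst hz).symm

/-- The projection of a smooth bundle is a submersion: a local trivialisation provides a smooth local
section through every point. -/
theorem surjective_mfderiv_proj_of_trivialization
    (he : ContMDiffOn 𝓘(ℝ, E) (𝓘(ℝ, EB).prod J) ∞ e e.source)
    (he' : ContMDiffOn (𝓘(ℝ, EB).prod J) 𝓘(ℝ, E) ∞ e.toOpenPartialHomeomorph.symm e.target)
    {x : Z} (hx : x ∈ e.source) :
    Function.Surjective (mfderiv 𝓘(ℝ, E) 𝓘(ℝ, EB) p x) := by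
  -- the local section of `p` through `x` which is constant in the trivialisation
  let σ : B → Z := fun b => e.toOpenPartialHomeomorph.symm (b, (e x).2)
  have hpx : ((p x, (e x).2) : B × F) = e x := Prod.ext (e.coe_fst hx).symm rfl
  have htgt : ((p x, (e x).2) : B × F) ∈ e.target := by
    rw [hpx]; exact e.map_source hx
  have hσx : σ (p x) = x := by
    change e.toOpenPartialHomeomorph.symm (p x, (e x).2) = x
    rw [hpx]; exact e.left_inv hx
  have hpair : ContMDiffAt 𝓘(ℝ, EB) (𝓘(ℝ, EB).prod J) ∞ (fun b : B => (b, (e x).2)) (p x) :=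
    contMDiffAt_id.prodMk contMDiffAt_const
  have hσ : MDifferentiableAt 𝓘(ℝ, EB) 𝓘(ℝ, E) σ (p x) :=
    (ContMDiffAt.comp (p x) (he'.contMDiffAt (e.open_target.mem_nhds htgt)) hpair).mdifferentiableAt
      (by simp)
  have hp : MDifferentiableAt 𝓘(ℝ, E) 𝓘(ℝ, EB) p (σ (p x)) := by
    rw [hσx]; exact (contMDiffAt_proj_of_trivialization he hx).mdifferentiableAt (by simp)
  have hid : p ∘ σ =ᶠ[nhds (p x)] id := by
    have : ∀ᶠ b in nhds (p x), ((b, (e x).2) : B × F) ∈ e.target :=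
      hpair.continuousAt (e.open_target.mem_nhds htgt)
    filter_upwards [this] with b hb
    exact e.proj_symm_apply hb
  have hcomp : (mfderiv 𝓘(ℝ, E) 𝓘(ℝ, EB) p (σ (p x))) ∘L (mfderiv 𝓘(ℝ, EB) 𝓘(ℝ, E) σ (p x)) =
      ContinuousLinearMap.id ℝ _ := by
    rw [← mfderiv_comp (p x) hp hσ, hid.mfderiv_eq, mfderiv_id]
  have hs : Function.Surjective (mfderiv 𝓘(ℝ, E) 𝓘(ℝ, EB) p (σ (p x))) := fun c =>
    ⟨_, DFunLike.congr_fun hcomp c⟩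
  rwa [hσx] at hs

/-- If the fibres are one-dimensional, any nonzero vertical vector spans the vertical space. -/
theorem exists_smul_eq_of_mfderiv_proj_eq_zero
    (he : ContMDiffOn 𝓘(ℝ, E) (𝓘(ℝ, EB).prod J) ∞ e e.source)
    (he' : ContMDiffOn (𝓘(ℝ, EB).prod J) 𝓘(ℝ, E) ∞ e.toOpenPartialHomeomorph.symm e.target)
    (hF : Module.finrank ℝ EF = 1) {x : Z} (hx : x ∈ e.source) {ξ u : TangentSpace 𝓘(ℝ, E) x}
    (hξ : mfderiv 𝓘(ℝ, E) 𝓘(ℝ, EB) p x ξ = 0) (hξ0 : ξ ≠ 0)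
    (hu : mfderiv 𝓘(ℝ, E) 𝓘(ℝ, EB) p x u = 0) : ∃ c : ℝ, c • ξ = u := by
  have hed : MDifferentiableAt 𝓘(ℝ, E) (𝓘(ℝ, EB).prod J) e x :=
    (he.contMDiffAt (e.open_source.mem_nhds hx)).mdifferentiableAt (by simp)
  have hed' : MDifferentiableAt (𝓘(ℝ, EB).prod J) 𝓘(ℝ, E) e.toOpenPartialHomeomorph.symm (e x) :=
    (he'.contMDiffAt (e.open_target.mem_nhds (e.map_source hx))).mdifferentiableAt (by simp)
  have hinj : Function.Injective (mfderiv 𝓘(ℝ, E) (𝓘(ℝ, EB).prod J) e x) := by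
    have hid : e.toOpenPartialHomeomorph.symm ∘ e =ᶠ[nhds x] id := by
      filter_upwards [e.open_source.mem_nhds hx] with z hz
      exact e.left_inv hz
    have hcomp : (mfderiv (𝓘(ℝ, EB).prod J) 𝓘(ℝ, E) e.toOpenPartialHomeomorph.symm (e x)) ∘L
        (mfderiv 𝓘(ℝ, E) (𝓘(ℝ, EB).prod J) e x) = mfderiv 𝓘(ℝ, E) 𝓘(ℝ, E) id x := by
      rw [← mfderiv_comp x hed' hed, hid.mfderiv_eq]
    rw [mfderiv_id] at hcomp
    intro v w hvw
    have hv := DFunLike.congr_fun hcomp v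
    have hw := DFunLike.congr_fun hcomp w
    change mfderiv _ _ _ _ (mfderiv _ _ _ _ v) = v at hv
    change mfderiv _ _ _ _ (mfderiv _ _ _ _ w) = w at hw
    rw [← hv, ← hw, hvw]
  -- in the trivialisation a vertical vector is determined by its component along the fibre
  let D : E →L[ℝ] EB × EF := mfderiv 𝓘(ℝ, E) (𝓘(ℝ, EB).prod J) e x
  have hfst (v : E) : (D v).1 = mfderiv 𝓘(ℝ, E) 𝓘(ℝ, EB) p x v := by
    have hev : p =ᶠ[nhds x] Prod.fst ∘ e := by
      filter_upwards [e.open_source.mem_nhds hx] with z hz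
      exact (e.coe_fst hz).symm
    rw [hev.mfderiv_eq, mfderiv_comp x mdifferentiableAt_fst hed, mfderiv_fst]
    rfl
  have hD0 (v : E) (hv : D v = 0) : v = 0 := hinj (hv.trans (map_zero D).symm)
  have hξ1 : (D ξ).1 = 0 := (hfst ξ).trans hξ
  have hu1 : (D u).1 = 0 := (hfst u).trans hu
  have hξ2 : (D ξ).2 ≠ 0 := fun h => hξ0 (hD0 ξ (Prod.ext hξ1 h))
  obtain ⟨c, hc⟩ := (finrank_eq_one_iff_of_nonzero' _ hξ2).1 hF (D u).2
  have hlin (v w : E) : D (c • v - w) = c • D v - D w := by rw [map_sub, map_smul]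
  refine ⟨c, sub_eq_zero.1 (hD0 _ ((hlin ξ u).trans (Prod.ext ?_ ?_)))⟩
  · change c • (D ξ).1 - (D u).1 = 0
    rw [hξ1, hu1, smul_zero, sub_zero]
  · change c • (D ξ).2 - (D u).2 = 0
    rw [hc, sub_self]

end Bundles

/-! ### Prequantum circle bundles -/

section Prequantum

variable {EB : Type*} [NormedAddCommGroup EB] [NormedSpace ℝ EB]
  {B : Type*} [TopologicalSpace B] [ChartedSpace EB B]
  {ES : Type*} [NormedAddCommGroup ES] [NormedSpace ℝ ES]
  {S : Type*} [TopologicalSpace S] [ChartedSpace ES S]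
  {EX : Type*} [NormedAddCommGroup EX] [NormedSpace ℝ EX]
  {X : Type*} [TopologicalSpace X] [ChartedSpace EX X]
  {p : S → B} {Ω : DiffForm ES S 2} {q : X → S} {Θ : DiffForm EX X 1}

theorem mem_verticalSpace_comp (hp : ContMDiff 𝓘(ℝ, ES) 𝓘(ℝ, EB) ∞ p)
    (hq : ContMDiff 𝓘(ℝ, EX) 𝓘(ℝ, ES) ∞ q) {x : X} {v : TangentSpace 𝓘(ℝ, EX) x} :
    v ∈ verticalSpace EB EX (p ∘ q) x ↔
      mfderiv 𝓘(ℝ, EX) 𝓘(ℝ, ES) q x v ∈ verticalSpace EB ES p (q x) := by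
  have h := mfderiv_comp x (hp.mdifferentiableAt (by simp) (x := q x))
    (hq.mdifferentiableAt (by simp) (x := x))
  change mfderiv 𝓘(ℝ, EX) 𝓘(ℝ, EB) (p ∘ q) x v = 0 ↔ _
  rw [h]
  rfl

theorem differential_comp {f : S → ℝ} (hf : ContMDiff 𝓘(ℝ, ES) 𝓘(ℝ, ℝ) ∞ f)
    (hq : ContMDiff 𝓘(ℝ, EX) 𝓘(ℝ, ES) ∞ q) (x : X) (v : TangentSpace 𝓘(ℝ, EX) x) :
    differential (f ∘ q) x v = differential f (q x) (mfderiv 𝓘(ℝ, EX) 𝓘(ℝ, ES) q x v) := by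
  rw [differential, mfderiv_comp x (hf.mdifferentiableAt (by simp)) (hq.mdifferentiableAt (by simp))]
  rfl

variable [MulAction Circle X]

theorem IsPrincipalCircleBundle.contMDiff (hq : IsPrincipalCircleBundle ES EX q) :
    ContMDiff 𝓘(ℝ, EX) 𝓘(ℝ, ES) ∞ q := fun x => by
  obtain ⟨e, he, h1, -⟩ := hq.exists_trivialization (q x)
  exact contMDiffAt_proj_of_trivialization h1 (e.mem_source.2 he)

theorem IsPrincipalCircleBundle.surjective_mfderiv (hq : IsPrincipalCircleBundle ES EX q) (x : X) :
    Function.Surjective (mfderiv 𝓘(ℝ, EX) 𝓘(ℝ, ES) q x) := by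
  obtain ⟨e, he, h1, h2, -⟩ := hq.exists_trivialization (q x)
  exact surjective_mfderiv_proj_of_trivialization h1 h2 (e.mem_source.2 he)

theorem IsPrincipalCircleBundle.apply_smul (hq : IsPrincipalCircleBundle ES EX q) (z : Circle)
    (x : X) : q (z • x) = q x := by
  obtain ⟨e, he, -, -, h⟩ := hq.exists_trivialization (q x)
  have hx := e.mem_source.2 he
  rw [← e.coe_fst hx, ← e.coe_fst (h z x hx).1, (h z x hx).2]

/-- The generator of the circle action is tangent to the fibres of `q`, and `Θ` equals `1` on it. -/
theorem IsPrequantumBundle.exists_generator (hX : IsPrequantumBundle Ω q Θ) (x : X) :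
    ∃ ξ : TangentSpace 𝓘(ℝ, EX) x, mfderiv 𝓘(ℝ, EX) 𝓘(ℝ, ES) q x ξ = 0 ∧ Θ x ![ξ] = 1 := by
  have hq := hX.isPrincipal
  have h0 : Circle.exp 0 • x = x := by rw [Circle.exp_zero, one_smul]
  suffices h : ∃ ξ : TangentSpace 𝓘(ℝ, EX) (Circle.exp 0 • x),
      mfderiv 𝓘(ℝ, EX) 𝓘(ℝ, ES) q (Circle.exp 0 • x) ξ = 0 ∧ Θ (Circle.exp 0 • x) ![ξ] = 1 by
    rwa [h0] at h
  -- `q` is constant along the orbits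
  refine ⟨mfderiv 𝓘(ℝ, ℝ) 𝓘(ℝ, EX) (fun t : ℝ => Circle.exp t • x) 0 (1 : ℝ), ?_,
    hX.isConnection.normalized x⟩
  have hγ : ContMDiff 𝓘(ℝ, ℝ) 𝓘(ℝ, EX) ∞ (fun t : ℝ => Circle.exp t • x) :=
    hq.contMDiff_smul.comp (contMDiff_circleExp.prodMk contMDiff_const)
  have hcomp := mfderiv_comp (0 : ℝ) (hq.contMDiff.mdifferentiableAt (by simp))
    (hγ.mdifferentiableAt (x := (0 : ℝ)) (by simp))
  have hconst : q ∘ (fun t : ℝ => Circle.exp t • x) = fun _ => q x :=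
    funext fun t => hq.apply_smul _ x
  rw [hconst, mfderiv_const] at hcomp
  exact (DFunLike.congr_fun hcomp (1 : ℝ)).symm

/-- A horizontal vector which is tangent to the fibres of `q` vanishes. -/
theorem IsPrequantumBundle.eq_zero_of_horizontal (hX : IsPrequantumBundle Ω q Θ) {x : X}
    {u : TangentSpace 𝓘(ℝ, EX) x} (hu : mfderiv 𝓘(ℝ, EX) 𝓘(ℝ, ES) q x u = 0)
    (hΘu : Θ x ![u] = 0) : u = 0 := by
  obtain ⟨ξ, hξ, hξ1⟩ := hX.exists_generator x
  obtain ⟨e, he, h1, h2, -⟩ := hX.isPrincipal.exists_trivialization (q x)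
  have hξ0 : ξ ≠ 0 := by
    rintro rfl
    rw [← oneFormLinear_apply, map_zero] at hξ1
    exact zero_ne_one hξ1
  obtain ⟨c, rfl⟩ := exists_smul_eq_of_mfderiv_proj_eq_zero h1 h2 (by simp) (e.mem_source.2 he)
    hξ hξ0 hu
  rw [← oneFormLinear_apply, map_smul, oneFormLinear_apply, hξ1, smul_eq_mul, mul_one] at hΘu
  rw [hΘu, zero_smul]

theorem IsPrequantumBundle.d_apply (hX : IsPrequantumBundle Ω q Θ) {x : X}
    (u v : TangentSpace 𝓘(ℝ, EX) x) :
    Θ.d x ![u, v] =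
      Ω (q x) ![mfderiv 𝓘(ℝ, EX) 𝓘(ℝ, ES) q x u, mfderiv 𝓘(ℝ, EX) 𝓘(ℝ, ES) q x v] := by
  rw [hX.curvature]
  change Ω (q x) _ = _
  congr 1
  ext i; fin_cases i <;> rfl

/-- Every tangent vector of `S` has a horizontal lift. -/
theorem IsPrequantumBundle.exists_lift (hX : IsPrequantumBundle Ω q Θ) {x : X}
    (u : TangentSpace 𝓘(ℝ, ES) (q x)) :
    ∃ v : TangentSpace 𝓘(ℝ, EX) x, mfderiv 𝓘(ℝ, EX) 𝓘(ℝ, ES) q x v = u ∧ Θ x ![v] = 0 := by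
  obtain ⟨ξ, hξ, hξ1⟩ := hX.exists_generator x
  obtain ⟨v, rfl⟩ := hX.isPrincipal.surjective_mfderiv x u
  refine ⟨v - Θ x ![v] • ξ, ?_, ?_⟩
  · rw [map_sub, map_smul, hξ, smul_zero, sub_zero]
  · rw [← oneFormLinear_apply, map_sub, map_smul, oneFormLinear_apply, oneFormLinear_apply, hξ1]
    simp

theorem IsPrequantumBundle.isFibrewiseContactForm (hX : IsPrequantumBundle Ω q Θ)
    (hp : ContMDiff 𝓘(ℝ, ES) 𝓘(ℝ, EB) ∞ p)
    (hnd : ∀ s, NondegenerateOn (Ω s) (verticalSpace EB ES p s)) :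
    IsFibrewiseContactForm EB (p ∘ q) Θ := by
  intro x
  have hv {v : TangentSpace 𝓘(ℝ, EX) x} :=
    mem_verticalSpace_comp (v := v) hp hX.isPrincipal.contMDiff
  obtain ⟨ξ, hξ, hξ1⟩ := hX.exists_generator x
  refine ⟨⟨ξ, ?_, by rw [hξ1]; exact one_ne_zero⟩, ?_⟩
  · rw [hv, hξ]
    exact Submodule.zero_mem _
  · rintro u ⟨hu, hΘu⟩ h
    refine hX.eq_zero_of_horizontal (hnd _ _ (hv.1 hu) fun w hw => ?_) hΘu
    obtain ⟨w, rfl, hΘw⟩ := hX.exists_lift w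
    rw [← hX.d_apply]
    exact h w ⟨hv.2 hw, hΘw⟩

/-- The sharp on `X` of a pulled back differential is the horizontal lift of the sharp on `S`. -/
theorem IsPrequantumBundle.mfderiv_sharp [FiniteDimensional ℝ ES]
    (hX : IsPrequantumBundle Ω q Θ)
    (hp : ContMDiff 𝓘(ℝ, ES) 𝓘(ℝ, EB) ∞ p)
    (hnd : ∀ s, NondegenerateOn (Ω s) (verticalSpace EB ES p s))
    {f : S → ℝ} (hf : ContMDiff 𝓘(ℝ, ES) 𝓘(ℝ, ℝ) ∞ f) (x : X) :
    mfderiv 𝓘(ℝ, EX) 𝓘(ℝ, ES) q x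
        (sharp (Θ.d x) (verticalContactSpace EB (p ∘ q) Θ x) (differential (f ∘ q) x)) =
      sharp (Ω (q x)) (verticalSpace EB ES p (q x)) (differential f (q x)) := by
  have hv {v : TangentSpace 𝓘(ℝ, EX) x} :=
    mem_verticalSpace_comp (v := v) hp hX.isPrincipal.contMDiff
  obtain ⟨v, hvu, hΘv⟩ :=
    hX.exists_lift (sharp (Ω (q x)) (verticalSpace EB ES p (q x)) (differential f (q x)))
  have hmem : v ∈ verticalSpace EB EX (p ∘ q) x := by
    rw [hv, hvu]
    exact sharp_mem (hnd _) _
  rw [sharp_eq (hX.isFibrewiseContactForm hp hnd x).2 (u := v) ⟨hmem, hΘv⟩ fun w hw => ?_, hvu]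
  rw [hX.d_apply, hvu, differential_comp hf hX.isPrincipal.contMDiff]
  exact apply_sharp (hnd _) _ (hv.1 hw.1)

variable [FiniteDimensional ℝ EX]

/-- The Reeb field is tangent to the fibres of `q`. -/
theorem IsPrequantumBundle.mfderiv_verticalReeb (hX : IsPrequantumBundle Ω q Θ)
    (hp : ContMDiff 𝓘(ℝ, ES) 𝓘(ℝ, EB) ∞ p)
    (hnd : ∀ s, NondegenerateOn (Ω s) (verticalSpace EB ES p s)) (x : X) :
    mfderiv 𝓘(ℝ, EX) 𝓘(ℝ, ES) q x (verticalReeb EB (p ∘ q) Θ x) = 0 := by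
  obtain ⟨hR, -, hR0⟩ := verticalReeb_spec (hX.isFibrewiseContactForm hp hnd) x
  have hv {v : TangentSpace 𝓘(ℝ, EX) x} :=
    mem_verticalSpace_comp (v := v) hp hX.isPrincipal.contMDiff
  refine hnd _ _ (hv.1 hR) fun w hw => ?_
  obtain ⟨w, rfl⟩ := hX.isPrincipal.surjective_mfderiv x w
  rw [← hX.d_apply]
  exact hR0 w (hv.2 hw)

theorem IsPrequantumBundle.fibrewiseContactBracket_comp [FiniteDimensional ℝ ES]
    (hX : IsPrequantumBundle Ω q Θ)
    (hp : ContMDiff 𝓘(ℝ, ES) 𝓘(ℝ, EB) ∞ p)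
    (hnd : ∀ s, NondegenerateOn (Ω s) (verticalSpace EB ES p s)) {f g : S → ℝ}
    (hf : ContMDiff 𝓘(ℝ, ES) 𝓘(ℝ, ℝ) ∞ f) (hg : ContMDiff 𝓘(ℝ, ES) 𝓘(ℝ, ℝ) ∞ g) :
    fibrewiseContactBracket EB (p ∘ q) Θ (f ∘ q) (g ∘ q) =
      fibrewisePoissonBracket EB p Ω f g ∘ q := by
  funext x
  have hR := hX.mfderiv_verticalReeb hp hnd x
  have hq := hX.isPrincipal.contMDiff
  simp only [fibrewiseContactBracket, fibrewisePoissonBracket, tensorBracket, Function.comp_apply,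
    inverseBivector]
  rw [hX.d_apply, hX.mfderiv_sharp hp hnd hf, hX.mfderiv_sharp hp hnd hg,
    differential_comp hg hq, differential_comp hf hq, hR]

end Prequantum

theorem mainTheorem12
    {EB : Type*} [NormedAddCommGroup EB] [NormedSpace ℝ EB] [FiniteDimensional ℝ EB]
    {EM : Type*} [NormedAddCommGroup EM] [NormedSpace ℝ EM] [FiniteDimensional ℝ EM]
    {ES : Type*} [NormedAddCommGroup ES] [NormedSpace ℝ ES] [FiniteDimensional ℝ ES]
    {EX : Type*} [NormedAddCommGroup EX] [NormedSpace ℝ EX] [FiniteDimensional ℝ EX]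
    {B : Type*} [TopologicalSpace B] [ChartedSpace EB B] [IsManifold 𝓘(ℝ, EB) ∞ B]
    {M : Type*} [TopologicalSpace M] [ChartedSpace EM M] [IsManifold 𝓘(ℝ, EM) ∞ M]
    {S : Type*} [TopologicalSpace S] [ChartedSpace ES S] [IsManifold 𝓘(ℝ, ES) ∞ S]
    {X : Type*} [TopologicalSpace X] [ChartedSpace EX X] [IsManifold 𝓘(ℝ, EX) ∞ X]
    [MulAction Circle X]
    (p : S → B) (Ω : DiffForm ES S 2) (q : X → S) (Θ : DiffForm EX X 1)
    (hS : IsSymplecticFibration EB EM M p Ω) (hΩ : Ω.IsClosed)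
    (hX : IsPrequantumBundle Ω q Θ) :
    IsFibrewiseContactForm EB (p ∘ q) Θ ∧
    IsPoissonBracket ES (fibrewisePoissonBracket EB p Ω) ∧
    IsJacobiMap EX ES (fibrewiseContactBracket EB (p ∘ q) Θ) (fibrewisePoissonBracket EB p Ω) q := by
  have hp : ContMDiff 𝓘(ℝ, ES) 𝓘(ℝ, EB) ∞ p := fun x => by
    obtain ⟨e, he, h1, -⟩ := hS.isSmoothFibreBundle (p x)
    exact contMDiffAt_proj_of_trivialization h1 (e.mem_source.2 he)
  have hps (x : S) : Function.Surjective (mfderiv 𝓘(ℝ, ES) 𝓘(ℝ, EB) p x) := by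
    obtain ⟨e, he, h1, h2⟩ := hS.isSmoothFibreBundle (p x)
    exact surjective_mfderiv_proj_of_trivialization h1 h2 (e.mem_source.2 he)
  have hq := hX.isPrincipal.contMDiff
  have hπs (x : X) : Function.Surjective (mfderiv 𝓘(ℝ, EX) 𝓘(ℝ, EB) (p ∘ q) x) := by
    rw [mfderiv_comp x (hp.mdifferentiableAt (by simp)) (hq.mdifferentiableAt (by simp))]
    exact (hps (q x)).comp (hX.isPrincipal.surjective_mfderiv x)
  have hΘ := hX.isFibrewiseContactForm hp hS.nondegenerate_on_fibres
  have hPoisson :=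
    isPoissonBracket_fibrewisePoissonBracket hp hps hΩ hS.nondegenerate_on_fibres
  exact ⟨hΘ, hPoisson, isJacobiBracket_fibrewiseContactBracket hΘ (hp.comp hq) hπs,
    hPoisson.toIsJacobiBracket, hq,
    fun f g hf hg => hX.fibrewiseContactBracket_comp hp hS.nondegenerate_on_fibres hf hg⟩
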